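/- Let $q$ be a complex number with $0<|q|<1$. Write $(x;q)_n=\prod_{i=0}^{n-1}(1-q^ix)$, $(x;q)_\infty=\prod_{i\ge 0}(1-q^ix)$, $j(x;q)=(x;q)_\infty(q/x;q)_\infty(q;q)_\infty$, $J_{a,m}=j(q^a;q^m)$ and $\overline{J}_{a,m}=j(-q^a;q^m)$. Let $$\phi(q)=\sum_{n\ge0}\frac{q^{n^2}}{(-q^2;q^2)_n},\quad \nu(q)=\sum_{n\ge0}\frac{q^{n(n+1)}}{(-q;q^2)_{n+1}},\quad \overline{\phi}_0(q)=\sum_{n\ge0}q^n(-q;q)_{2n+1},\quad \overline{\phi}_1(q)=\sum_{n\ge0}q^n(-q;q)_{2n}.$$ Let $\mathrm{sg}(r)=1$ for $r\ge0$ and $\mathrm{sg}(r)=-1$ for $r<0$, and for $x,y\in\mathbb{C}\setminus\{0\}$ let $$f_{a,b,c}(x,y,q)=\sum_{\mathrm{sg}(r)=\mathrm{sg}(s)}\mathrm{sg}(r)(-1)^{r+s}x^ry^sq^{a\binom r2+brs+c\binom s2},$$ the sum being over pairs of integers $(r,s)$. Let $\sum^{*}_{n,j}$ denote $\sum_{n+j\ge0,\,n-j\ge0}-\sum_{n+j<0,\,n-j<0}$,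 the sums being over pairs of integers $(n,j)$. Then all the series involved converge (those over pairs of integers absolutely), and $$\begin{aligned} \overline{J}_{1,4}\,\phi(q)&=\sum_{n\ge0}(-1)^nq^{2n^2+n}(1+q^{2n+1})\sum_{j=-n}^n(-1)^jq^{-3j^2/2+j/2}\\ &=\sum\nolimits^{*}_{n,j}(-1)^{n+j}q^{2n^2+n-3j^2/2+j/2}=f_{1,7,1}(-q,-q^2,q)+q\,f_{1,7,1}(-q^3,-q^4,q),\\[4pt] \overline{J}_{1,4}\,\nu(q)&=\sum_{n\ge0}(-1)^nq^{2n^2+2n}\sum_{j=-n}^n(-1)^jq^{-3j^2/2+j/2}\\ &=\tfrac12\sum\nolimits^{*}_{n,j}(-1)^{n+j}q^{2n^2+2n-3j^2/2+j/2}=f_{1,7,1}(-q^2,-q^3,q),\\[4pt] J_{1,2}\,\bigl(q\overline{\phi}_0(q)+1\bigr)&=\sum_{n\ge0}q^{4n^2+n}(1-q^{6n+3})\sum_{j=-n}^n(-1)^jq^{-3j^2-j}\\ &=\sum\nolimits^{*}_{n,j}(-1)^{j}q^{4n^2+n-3j^2-j}=f_{1,7,1}(q,q^3,q^2)+q^5f_{1,7,1}(q^9,q^{11},q^2),\\[4pt]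 J_{1,2}\,\overline{\phi}_1(q)&=\sum_{n\ge0}q^{4n^2+3n}(1-q^{2n+1})\sum_{j=-n}^n(-1)^jq^{-3j^2-j}\\ &=\sum\nolimits^{*}_{n,j}(-1)^{j}q^{4n^2+3n-3j^2-j}=f_{1,7,1}(q^3,q^5,q^2)+q^7f_{1,7,1}(q^{11},q^{13},q^2). \end{aligned}$$ -/

import Mathlib

namespace HeckeMock

/-- The finite `q`-Pochhammer symbol `(x; q)_n = ∏_{i=0}^{n-1} (1 - q^i x)`. -/
noncomputable def qPoch (x q : ℂ) (n : ℕ) : ℂ := ∏ i ∈ Finset.range n, (1 - q ^ i * x)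

/-- The infinite `q`-Pochhammer symbol `(x; q)_∞ = ∏_{i ≥ 0} (1 - q^i x)`. -/
noncomputable def qPochInf (x q : ℂ) : ℂ := ∏' i : ℕ, (1 - q ^ i * x)

/-- The infinite product `(x; q)_∞` converges for `|q| < 1`, so that `qPochInf` is its value. -/
theorem multipliable_qPochInf (x q : ℂ) (hq : ‖q‖ < 1) :
    Multipliable (fun i : ℕ => 1 - q ^ i * x) := by
  have h : Summable (fun i : ℕ => ‖-(q ^ i * x)‖) := by
    simpa [norm_mul, norm_pow] using
      (summable_geometric_of_lt_one (norm_nonneg q) hq).mul_right ‖x‖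
  simpa [sub_eq_add_neg] using multipliable_one_add_of_summable h

/-- The theta function `j(x; q) = (x; q)_∞ (q/x; q)_∞ (q; q)_∞`. -/
noncomputable def jTheta (x q : ℂ) : ℂ := qPochInf x q * qPochInf (q / x) q * qPochInf q q

/-- `J_{a,m} = j(q^a; q^m)`. -/
noncomputable def J (a : ℤ) (m : ℕ) (q : ℂ) : ℂ := jTheta (q ^ a) (q ^ m)

/-- `J̄_{a,m} = j(-q^a; q^m)`. -/
noncomputable def Jbar (a : ℤ) (m : ℕ) (q : ℂ) : ℂ := jTheta (-q ^ a) (q ^ m)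

/-- The `n`-th term of the third order mock theta function `φ`. -/
noncomputable def phiTerm (q : ℂ) (n : ℕ) : ℂ := q ^ (n ^ 2) / qPoch (-q ^ 2) (q ^ 2) n

/-- The third order mock theta function `φ(q) = ∑_{n ≥ 0} q^{n²} / (-q²; q²)_n`. -/
noncomputable def phi (q : ℂ) : ℂ := ∑' n : ℕ, phiTerm q n

/-- The `n`-th term of the third order mock theta function `ν`. -/
noncomputable def nuTerm (q : ℂ) (n : ℕ) : ℂ := q ^ (n * (n + 1)) / qPoch (-q) (q ^ 2) (n + 1)

/-- The third order mock theta function `ν(q) = ∑_{n ≥ 0} q^{n(n+1)} / (-q; q²)_{n+1}`. -/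
noncomputable def nu (q : ℂ) : ℂ := ∑' n : ℕ, nuTerm q n

/-- The `n`-th term of `φ̄₀`. -/
noncomputable def phibar0Term (q : ℂ) (n : ℕ) : ℂ := q ^ n * qPoch (-q) q (2 * n + 1)

/-- The Bringmann–Hikami–Lovejoy function `φ̄₀(q) = ∑_{n ≥ 0} q^n (-q; q)_{2n+1}`. -/
noncomputable def phibar0 (q : ℂ) : ℂ := ∑' n : ℕ, phibar0Term q n

/-- The `n`-th term of `φ̄₁`. -/
noncomputable def phibar1Term (q : ℂ) (n : ℕ) : ℂ := q ^ n * qPoch (-q) q (2 * n)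

/-- The Bringmann–Hikami–Lovejoy function `φ̄₁(q) = ∑_{n ≥ 0} q^n (-q; q)_{2n}`. -/
noncomputable def phibar1 (q : ℂ) : ℂ := ∑' n : ℕ, phibar1Term q n

/-- `sg(r) = 1` for `r ≥ 0` and `sg(r) = -1` for `r < 0`. -/
def sg (r : ℤ) : ℤ := if 0 ≤ r then 1 else -1

/-- The summand of `f_{a,b,c}(x, y, q)`; here `r * (r - 1) / 2` is the binomial coefficient
`r choose 2`, the division being exact. -/
noncomputable def fTerm (a b c : ℤ) (x y q : ℂ) (p : {p : ℤ × ℤ // sg p.1 = sg p.2}) : ℂ :=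
  (sg p.1.1 : ℂ) * (-1) ^ (p.1.1 + p.1.2) * x ^ p.1.1 * y ^ p.1.2 *
    q ^ (a * (p.1.1 * (p.1.1 - 1) / 2) + b * p.1.1 * p.1.2 + c * (p.1.2 * (p.1.2 - 1) / 2))

/-- The Hecke-type double sum `f_{a,b,c}(x, y, q)`, a sum over all pairs of integers `(r, s)` with
`sg(r) = sg(s)`. -/
noncomputable def f (a b c : ℤ) (x y q : ℂ) : ℂ := ∑' p, fTerm a b c x y q p

/-- `HasIndefSum t S` says that
`(∑_{n+j ≥ 0, n-j ≥ 0} - ∑_{n+j < 0, n-j < 0}) t(n, j) = S`, both sums over pairs of integers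
`(n, j)` being (absolutely) convergent. -/
def HasIndefSum (t : ℤ → ℤ → ℂ) (S : ℂ) : Prop :=
  ∃ u v : ℂ,
    HasSum (fun p : {p : ℤ × ℤ // 0 ≤ p.1 + p.2 ∧ 0 ≤ p.1 - p.2} => t p.1.1 p.1.2) u ∧
    HasSum (fun p : {p : ℤ × ℤ // p.1 + p.2 < 0 ∧ p.1 - p.2 < 0} => t p.1.1 p.1.2) v ∧
    S = u - v

/-- The inner sum `∑_{j=-n}^{n} (-1)^j q^{-3j²/2 + j/2}`; the division `j(3j-1)/2` is exact. -/
noncomputable def innerA (q : ℂ) (n : ℕ) : ℂ :=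
  ∑ j ∈ Finset.Icc (-(n : ℤ)) n, (-1) ^ j * q ^ (-(j * (3 * j - 1) / 2))

/-- The inner sum `∑_{j=-n}^{n} (-1)^j q^{-3j² - j}`. -/
noncomputable def innerB (q : ℂ) (n : ℕ) : ℂ :=
  ∑ j ∈ Finset.Icc (-(n : ℤ)) n, (-1) ^ j * q ^ (-3 * j ^ 2 - j)

end HeckeMock

/-!
For the Bailey pair relative to `q` with `β = 1`, inverting the Bailey kernel gives
`α_r = (1 - q^{2r+1}) q^{2r²+r} ∑_{|j| ≤ r} (-1)^j q^{-3j²/2 + j/2}`, since the sums `innerA`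
satisfy the same first-order recurrence as the inverted sums. A kernel recurrence turns it into
a second pair, with `β_n = q^{n+1} + [n = 0]`. Inserting these pairs, with base `q` or `q²`, into
two limiting cases of Bailey's lemma gives the four sums over `n`; the resulting `q`-series are
`φ` and `ν` by Fine's functional equation, and `φ̄₀`, `φ̄₁` directly. The reflection `n ↦ -1 - n`
folds the indefinite sum into these sums over `n`, and splitting it by the parity of `n + j` (with
`n - j` and `n + j` equal to `2r, 2s` or `2r + 1, 2s + 1`) produces the two Hecke-type sums.
-/

namespace HeckeMock

open Filter Topology

/-! ### The finite `q`-Pochhammer symbol -/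

theorem qPoch_zero (x q : ℂ) : qPoch x q 0 = 1 := by simp [qPoch]

theorem qPoch_succ (x q : ℂ) (n : ℕ) : qPoch x q (n + 1) = qPoch x q n * (1 - q ^ n * x) := by
  simp [qPoch, Finset.prod_range_succ]

theorem qPoch_self_succ (q : ℂ) (n : ℕ) :
    qPoch q q (n + 1) = qPoch q q n * (1 - q ^ (n + 1)) := by
  rw [qPoch_succ, pow_succ]

theorem qPoch_add (x q : ℂ) (m n : ℕ) :
    qPoch x q (m + n) = qPoch x q m * qPoch (q ^ m * x) q n := by
  simp only [qPoch, Finset.prod_range_add, pow_add, mul_assoc, mul_left_comm]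

theorem qPoch_two_mul (x q : ℂ) (n : ℕ) :
    qPoch x q (2 * n) = qPoch x (q ^ 2) n * qPoch (q * x) (q ^ 2) n := by
  induction n with
  | zero => simp [qPoch_zero]
  | succ n ih =>
    rw [mul_add_one, qPoch_succ, qPoch_succ, ih, qPoch_succ, qPoch_succ]
    ring

theorem qPoch_mul_neg (x q : ℂ) (n : ℕ) :
    qPoch x q n * qPoch (-x) q n = qPoch (x ^ 2) (q ^ 2) n := by
  simp only [qPoch, ← Finset.prod_mul_distrib]
  exact Finset.prod_congr rfl fun i _ => by ring

theorem qPoch_ne_zero {x q : ℂ} (hx : ∀ i : ℕ, 1 - q ^ i * x ≠ 0) (n : ℕ) : qPoch x q n ≠ 0 :=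
  Finset.prod_ne_zero_iff.mpr fun i _ => hx i

theorem one_sub_pow_ne_zero {q : ℂ} (hq : ¬IsOfFinOrder q) {n : ℕ} (hn : n ≠ 0) :
    1 - q ^ n ≠ 0 := fun h =>
  hq (isOfFinOrder_iff_pow_eq_one.mpr ⟨n, hn.bot_lt, (sub_eq_zero.mp h).symm⟩)

theorem qPoch_self_ne_zero {q : ℂ} (hq : ¬IsOfFinOrder q) (n : ℕ) : qPoch q q n ≠ 0 :=
  qPoch_ne_zero (fun i => by simpa only [pow_succ] using one_sub_pow_ne_zero hq i.succ_ne_zero) n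

/-- The reciprocal `1 / (q; q)_k`, extended by zero to negative `k` so that the recurrence
`qPochInv_sub_one` holds for every integer `k`. -/
noncomputable def qPochInv (q : ℂ) (k : ℤ) : ℂ :=
  if 0 ≤ k then (qPoch q q k.toNat)⁻¹ else 0

theorem qPochInv_natCast (q : ℂ) (k : ℕ) : qPochInv q k = (qPoch q q k)⁻¹ := by
  simp [qPochInv]

theorem qPochInv_zero (q : ℂ) : qPochInv q 0 = 1 := by
  simp [qPochInv, qPoch_zero]

theorem qPochInv_of_neg (q : ℂ) {k : ℤ} (hk : k < 0) : qPochInv q k = 0 := by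
  simp [qPochInv, hk]

theorem qPochInv_sub_one {q : ℂ} (hq : ¬IsOfFinOrder q) (k : ℤ) :
    qPochInv q (k - 1) = (1 - q ^ k) * qPochInv q k := by
  rcases lt_trichotomy k 0 with hk | rfl | hk
  · rw [qPochInv_of_neg q hk, qPochInv_of_neg q (by omega), mul_zero]
  · rw [qPochInv_of_neg q (by omega), zpow_zero, sub_self, zero_mul]
  · obtain ⟨m, rfl⟩ : ∃ m : ℕ, k = (m + 1 : ℕ) := ⟨(k - 1).toNat, by omega⟩
    rw [Nat.cast_succ, add_sub_cancel_right, ← Nat.cast_succ, qPochInv_natCast, qPochInv_natCast,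
      qPoch_self_succ, zpow_natCast]
    have := one_sub_pow_ne_zero hq m.succ_ne_zero
    field_simp

/-- The binomial coefficient `i choose 2` of an integer. -/
def chooseTwo (i : ℤ) : ℤ := i * (i - 1) / 2

theorem two_mul_chooseTwo (i : ℤ) : 2 * chooseTwo i = i * (i - 1) :=
  Int.mul_ediv_cancel' (even_iff_two_dvd.mp (Int.even_mul_pred_self i))

theorem chooseTwo_add_one (i : ℤ) : chooseTwo (i + 1) = chooseTwo i + i := by
  linarith [two_mul_chooseTwo i, two_mul_chooseTwo (i + 1)]

/-! ### Bailey pairs -/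

/-- The Bailey kernel `1 / ((q; q)_{n-r} (q; q)_{n+r+1})`. -/
noncomputable def baileyKernel (q : ℂ) (n r : ℕ) : ℂ :=
  qPochInv q (n - r) * qPochInv q (n + r + 1)

/-- `(α, β)` is a Bailey pair relative to `q`, the usual factor `1 - q` being absorbed into `β`. -/
def IsBaileyPair (q : ℂ) (α β : ℕ → ℂ) : Prop :=
  ∀ n, ∑ r ∈ Finset.range (n + 1), α r * baileyKernel q n r = β n

theorem IsBaileyPair.add {q : ℂ} {α α' β β' : ℕ → ℂ} (h : IsBaileyPair q α β)
    (h' : IsBaileyPair q α' β') :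
    IsBaileyPair q (fun r => α r + α' r) (fun n => β n + β' n) := fun n => by
  simp only [add_mul, Finset.sum_add_distrib, h n, h' n]

theorem IsBaileyPair.const_mul {q : ℂ} {α β : ℕ → ℂ} (h : IsBaileyPair q α β) (c : ℂ) :
    IsBaileyPair q (fun r => c * α r) (fun n => c * β n) := fun n => by
  simp only [mul_assoc, ← Finset.mul_sum, h n]

/-- The entries `(-1)^{r-j} q^{(r-j choose 2)} (q; q)_{r+j} / (q; q)_{r-j}` of the matrix that,
up to the factors `1 - q^{2r+1}`, inverts the Bailey kernel. -/
noncomputable def baileyInvKernel (q : ℂ) (r j : ℕ) : ℂ :=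
  (-1) ^ (r + j) * q ^ chooseTwo (r - j) * qPoch q q (r + j) * qPochInv q (r - j)

theorem baileyKernel_of_lt (q : ℂ) {n r : ℕ} (h : n < r) : baileyKernel q n r = 0 := by
  rw [baileyKernel, qPochInv_of_neg q (by omega), zero_mul]

theorem baileyKernel_succ_left {q : ℂ} (hq : ¬IsOfFinOrder q) (n r : ℕ) :
    baileyKernel q n r =
      (1 - q ^ ((n : ℤ) + 1 - r)) * (1 - q ^ (n + r + 2)) * baileyKernel q (n + 1) r := by
  have h₁ := qPochInv_sub_one hq ((n : ℤ) + 1 - r)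
  have h₂ := qPochInv_sub_one hq ((n : ℤ) + r + 2)
  rw [show (n : ℤ) + 1 - r - 1 = n - r by ring] at h₁
  rw [show (n : ℤ) + r + 2 - 1 = n + r + 1 by ring] at h₂
  rw [baileyKernel, baileyKernel, h₁, h₂, Nat.cast_succ,
    show (n : ℤ) + 1 + r + 1 = n + r + 2 by ring, show (n : ℤ) + r + 2 = (n + r + 2 : ℕ) by simp,
    zpow_natCast]
  ring

theorem baileyInvKernel_of_lt (q : ℂ) {r j : ℕ} (h : r < j) : baileyInvKernel q r j = 0 := by
  rw [baileyInvKernel, qPochInv_of_neg q (by omega), mul_zero]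

theorem baileyInvKernel_mul_baileyKernel_self {q : ℂ} (hq : ¬IsOfFinOrder q) (n : ℕ) :
    (1 - q ^ (2 * n + 1)) * baileyInvKernel q n n * baileyKernel q n n = 1 := by
  have h₁ := one_sub_pow_ne_zero hq (2 * n).succ_ne_zero
  have h₂ := qPoch_self_ne_zero hq (2 * n)
  have h₃ : (n : ℤ) + n + 1 = (2 * n + 1 : ℕ) := by push_cast; ring
  rw [baileyInvKernel, baileyKernel, h₃, sub_self, qPochInv_zero, qPochInv_natCast, ← two_mul,
    qPoch_self_succ]
  simp only [chooseTwo, pow_mul]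
  field_simp
  simp

theorem sum_baileyInvKernel_mul_baileyKernel_of_lt {q : ℂ} (hq0 : q ≠ 0) (hq : ¬IsOfFinOrder q)
    {n j : ℕ} (hj : j < n) :
    ∑ r ∈ Finset.range (n + 1),
      (1 - q ^ (2 * r + 1)) * baileyInvKernel q r j * baileyKernel q n r = 0 := by
  let G (r : ℕ) : ℂ := (-1) ^ (r + j) * q ^ chooseTwo (r - j) * qPoch q q (r + j) *
    qPochInv q (r - j - 1) * qPochInv q (n - r) * qPochInv q (n + r)
  have telescope (r : ℕ) : (1 - q ^ ((n : ℤ) - j)) *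
      ((1 - q ^ (2 * r + 1)) * baileyInvKernel q r j * baileyKernel q n r) = G r - G (r + 1) := by
    have h₁ : ((r + 1 : ℕ) : ℤ) - j = r - j + 1 := by push_cast; ring
    have h₂ : (n : ℤ) - (r + 1 : ℕ) = n - r - 1 := by push_cast; ring
    have h₃ := qPochInv_sub_one hq ((n : ℤ) + r + 1)
    rw [add_sub_cancel_right] at h₃
    simp only [G]
    rw [baileyInvKernel, baileyKernel, h₁, h₂, add_sub_cancel_right, chooseTwo_add_one,
      qPochInv_sub_one hq, qPochInv_sub_one hq, h₃, Nat.cast_succ, ← add_assoc,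
      add_right_comm r 1 j, qPoch_self_succ q (r + j)]
    simp only [zpow_sub₀ hq0, zpow_add₀ hq0, zpow_natCast, zpow_one]
    field_simp
    ring
  have hne : 1 - q ^ ((n : ℤ) - j) ≠ 0 := by
    rw [← Nat.cast_sub hj.le, zpow_natCast]
    exact one_sub_pow_ne_zero hq (by omega)
  have hG0 : G 0 = 0 := by
    simp only [G]; rw [qPochInv_of_neg q (k := ((0 : ℕ) : ℤ) - j - 1) (by omega)]; ring
  have hGn : G (n + 1) = 0 := by
    simp only [G]; rw [qPochInv_of_neg q (k := (n : ℤ) - (n + 1 : ℕ)) (by omega)]; ring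
  refine (mul_eq_zero.mp ?_).resolve_left hne
  rw [Finset.mul_sum, Finset.sum_congr rfl fun r _ => telescope r, Finset.sum_range_sub', hG0, hGn,
    sub_zero]

theorem sum_baileyInvKernel_mul_baileyKernel {q : ℂ} (hq0 : q ≠ 0) (hq : ¬IsOfFinOrder q)
    {n j : ℕ} (hj : j ≤ n) :
    ∑ r ∈ Finset.range (n + 1),
      (1 - q ^ (2 * r + 1)) * baileyInvKernel q r j * baileyKernel q n r =
        if j = n then 1 else 0 := by
  split_ifs with h
  · subst h
    rw [Finset.sum_range_succ, baileyInvKernel_mul_baileyKernel_self hq, add_eq_right]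
    refine Finset.sum_eq_zero fun r hr => ?_
    rw [baileyInvKernel_of_lt q (Finset.mem_range.mp hr), mul_zero, zero_mul]
  · exact sum_baileyInvKernel_mul_baileyKernel_of_lt hq0 hq (hj.lt_of_ne h)

theorem isBaileyPair_sum_baileyInvKernel {q : ℂ} (hq0 : q ≠ 0) (hq : ¬IsOfFinOrder q)
    (β : ℕ → ℂ) :
    IsBaileyPair q (fun r => (1 - q ^ (2 * r + 1)) *
      ∑ j ∈ Finset.range (r + 1), baileyInvKernel q r j * β j) β := by
  intro n
  have extend : ∀ r ∈ Finset.range (n + 1), (1 - q ^ (2 * r + 1)) *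
      (∑ j ∈ Finset.range (r + 1), baileyInvKernel q r j * β j) * baileyKernel q n r =
      ∑ j ∈ Finset.range (n + 1),
        (1 - q ^ (2 * r + 1)) * baileyInvKernel q r j * baileyKernel q n r * β j := by
    intro r hr
    rw [Finset.sum_subset (Finset.range_mono (Nat.succ_le_of_lt (Finset.mem_range.mp hr)))
      fun j _ hj => by rw [baileyInvKernel_of_lt q (by simpa using hj), zero_mul], Finset.mul_sum,
      Finset.sum_mul]
    exact Finset.sum_congr rfl fun j _ => by ring
  have inner : ∀ j ∈ Finset.range (n + 1), ∑ r ∈ Finset.range (n + 1),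
      (1 - q ^ (2 * r + 1)) * baileyInvKernel q r j * baileyKernel q n r * β j =
        if j = n then β j else 0 := fun j hj => by
    rw [← Finset.sum_mul, sum_baileyInvKernel_mul_baileyKernel hq0 hq
      (Finset.mem_range_succ_iff.mp hj), ite_mul, one_mul, zero_mul]
  rw [Finset.sum_congr rfl extend, Finset.sum_comm, Finset.sum_congr rfl inner]
  simp

/-- The Bailey kernel satisfies
`q^{n+1-r} (1 + q^{2r+1}) K(n+1, r) = (1 + q^{2n+3}) K(n+1, r) - K(n, r)`. -/
theorem IsBaileyPair.mul_one_add {q : ℂ} (hq0 : q ≠ 0) (hq : ¬IsOfFinOrder q) {α β : ℕ → ℂ}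
    (h : IsBaileyPair q α β) :
    IsBaileyPair q (fun r => (q ^ r)⁻¹ * (1 + q ^ (2 * r + 1)) * α r)
      (fun n => (q ^ n)⁻¹ * ((1 + q ^ (2 * n + 1)) * β n - if n = 0 then 0 else β (n - 1))) := by
  rintro (_ | n)
  · have h₀ := h 0
    simp only [Finset.sum_range_one, zero_add] at h₀ ⊢
    simp [← h₀, mul_assoc]
  · have kernel (r : ℕ) : (q ^ r)⁻¹ * (1 + q ^ (2 * r + 1)) * α r * baileyKernel q (n + 1) r =
        (q ^ (n + 1))⁻¹ * ((1 + q ^ (2 * n + 3)) * (α r * baileyKernel q (n + 1) r) -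
          α r * baileyKernel q n r) := by
      rw [baileyKernel_succ_left hq n r, zpow_sub₀ hq0, zpow_add₀ hq0]
      simp only [zpow_natCast, zpow_one]
      field_simp
      ring
    have hn : ∑ r ∈ Finset.range (n + 2), α r * baileyKernel q n r = β n := by
      rw [Finset.sum_range_succ, h n, baileyKernel_of_lt q n.lt_succ_self, mul_zero, add_zero]
    simp only [kernel, ← Finset.mul_sum, Finset.sum_sub_distrib, hn, h (n + 1), n.succ_ne_zero,
      if_false, Nat.add_sub_cancel]
    ring_nf

theorem sum_baileyInvKernel_succ {q : ℂ} (hq0 : q ≠ 0) (hq : ¬IsOfFinOrder q) (r : ℕ) :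
    ∑ j ∈ Finset.range (r + 2), baileyInvKernel q (r + 1) j =
      q ^ (4 * r + 3) * ∑ j ∈ Finset.range (r + 1), baileyInvKernel q r j +
        (-1) ^ (r + 1) * q ^ chooseTwo (r + 2) * (1 + q ^ (r + 1)) := by
  let G (j : ℕ) : ℂ := (-1) ^ (r + 1 + j) * q ^ chooseTwo (r + 1 - j) * qPoch q q (r + j) *
    qPochInv q (r + 1 - j) * q ^ ((r : ℤ) + 1 - j) * (1 - q ^ (2 * (r + 1)))
  have telescope (j : ℕ) :
      baileyInvKernel q (r + 1) j - q ^ (4 * r + 3) * baileyInvKernel q r j = G j - G (j + 1) := by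
    have h₁ : (r : ℤ) + 1 - (j + 1 : ℕ) = r - j := by push_cast; ring
    have h₂ : (r : ℤ) + 1 - j = r - j + 1 := by ring
    have h₃ : qPochInv q (r - j) = (1 - q ^ ((r : ℤ) - j + 1)) * qPochInv q (r - j + 1) := by
      rw [← qPochInv_sub_one hq, add_sub_cancel_right]
    simp only [G]
    rw [baileyInvKernel, baileyInvKernel, Nat.cast_succ, h₁, h₂, h₃, chooseTwo_add_one,
      add_right_comm r 1 j, ← add_assoc r j 1, qPoch_self_succ]
    simp only [zpow_add₀ hq0, zpow_sub₀ hq0, zpow_natCast, zpow_one]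
    field_simp
    ring
  have hG0 : G 0 = (-1) ^ (r + 1) * q ^ chooseTwo (r + 2) * (1 + q ^ (r + 1)) := by
    have h₁ : (r : ℤ) + 1 - (0 : ℕ) = (r + 1 : ℕ) := by simp
    have h₂ : (r : ℤ) + 2 = (r + 1 : ℕ) + 1 := by push_cast; ring
    have h₃ := qPoch_self_ne_zero hq (r + 1)
    rw [qPoch_self_succ] at h₃
    simp only [G]
    rw [h₁, h₂, chooseTwo_add_one, qPochInv_natCast, zpow_add₀ hq0, zpow_natCast, add_zero,
      add_zero, qPoch_self_succ]
    field_simp [left_ne_zero_of_mul h₃, right_ne_zero_of_mul h₃]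
    ring
  have hGr : G (r + 2) = 0 := by
    simp only [G]; rw [qPochInv_of_neg q (k := (r : ℤ) + 1 - (r + 2 : ℕ)) (by omega)]; ring
  have h := Finset.sum_congr (rfl : Finset.range (r + 2) = _) fun j _ => telescope j
  rw [Finset.sum_range_sub', hG0, hGr, Finset.sum_sub_distrib, ← Finset.mul_sum,
    Finset.sum_range_succ (fun j => baileyInvKernel q r j),
    baileyInvKernel_of_lt q r.lt_succ_self, add_zero] at h
  linear_combination h

theorem innerA_succ (q : ℂ) (n : ℕ) :
    innerA q (n + 1) = innerA q n +
      (-1) ^ (n + 1) * (q ^ (-chooseTwo (n + 2) - 2 * chooseTwo (n + 1)) +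
        q ^ (-chooseTwo (n + 2) - 2 * chooseTwo (n + 1) - (n + 1))) := by
  have hIcc : Finset.Icc (-((n + 1 : ℕ) : ℤ)) ((n + 1 : ℕ) : ℤ) =
      insert (-((n + 1 : ℕ) : ℤ)) (insert ((n + 1 : ℕ) : ℤ) (Finset.Icc (-(n : ℤ)) n)) := by
    ext x; simp only [Finset.mem_Icc, Finset.mem_insert]; omega
  have d₁ := two_mul_chooseTwo ((n : ℤ) + 2)
  have d₂ := two_mul_chooseTwo ((n : ℤ) + 1)
  have hpos : ((n + 1 : ℕ) : ℤ) * (3 * ((n + 1 : ℕ) : ℤ) - 1) / 2 =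
      chooseTwo (n + 2) + 2 * chooseTwo (n + 1) :=
    Int.ediv_eq_of_eq_mul_right two_ne_zero <| by push_cast; linear_combination -d₁ - 2 * d₂
  have hneg : -((n + 1 : ℕ) : ℤ) * (3 * -((n + 1 : ℕ) : ℤ) - 1) / 2 =
      chooseTwo (n + 2) + 2 * chooseTwo (n + 1) + (n + 1) :=
    Int.ediv_eq_of_eq_mul_right two_ne_zero <| by push_cast; linear_combination -d₁ - 2 * d₂
  have hsign : (-1 : ℂ) ^ (-((n + 1 : ℕ) : ℤ)) = (-1) ^ (n + 1) := by
    rw [zpow_neg, zpow_natCast, ← inv_pow, inv_neg_one]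
  rw [innerA, hIcc, Finset.sum_insert, Finset.sum_insert, hpos, hneg, hsign, zpow_natCast, ← innerA]
  · ring_nf
  · simp
  · simp only [Finset.mem_insert, Finset.mem_Icc]; omega

theorem sum_baileyInvKernel {q : ℂ} (hq0 : q ≠ 0) (hq : ¬IsOfFinOrder q) (r : ℕ) :
    ∑ j ∈ Finset.range (r + 1), baileyInvKernel q r j = q ^ (2 * r ^ 2 + r) * innerA q r := by
  induction r with
  | zero => simp [innerA, baileyInvKernel, chooseTwo, qPochInv_zero, qPoch_zero]
  | succ r ih =>
    have d₁ := two_mul_chooseTwo ((r : ℤ) + 2)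
    have d₂ := two_mul_chooseTwo ((r : ℤ) + 1)
    have h₁ : q ^ (2 * (r + 1) ^ 2 + (r + 1)) *
        q ^ (-chooseTwo (r + 2) - 2 * chooseTwo (r + 1)) = q ^ chooseTwo (r + 2) * q ^ (r + 1) := by
      simp only [← zpow_natCast, ← zpow_add₀ hq0]
      congr 1; push_cast; linear_combination -d₁ - d₂
    have h₂ : q ^ (2 * (r + 1) ^ 2 + (r + 1)) *
        q ^ (-chooseTwo (r + 2) - 2 * chooseTwo (r + 1) - (r + 1)) = q ^ chooseTwo (r + 2) := by
      simp only [← zpow_natCast, ← zpow_add₀ hq0]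
      congr 1; push_cast; linear_combination -d₁ - d₂
    rw [sum_baileyInvKernel_succ hq0 hq, ih, innerA_succ]
    linear_combination -(-1) ^ (r + 1) * (h₁ + h₂)

theorem isBaileyPair_innerA_one {q : ℂ} (hq0 : q ≠ 0) (hq : ¬IsOfFinOrder q) :
    IsBaileyPair q (fun r => (1 - q ^ (2 * r + 1)) * (q ^ (2 * r ^ 2 + r) * innerA q r))
      (fun _ => 1) := by
  simpa only [mul_one, sum_baileyInvKernel hq0 hq] using
    isBaileyPair_sum_baileyInvKernel hq0 hq fun _ => 1

theorem isBaileyPair_innerA_pow {q : ℂ} (hq0 : q ≠ 0) (hq : ¬IsOfFinOrder q) :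
    IsBaileyPair q (fun r => (1 - q ^ (4 * r + 2)) * (q ^ (2 * r ^ 2) * innerA q r))
      (fun n => q ^ (n + 1) + if n = 0 then 1 else 0) := by
  convert (isBaileyPair_innerA_one hq0 hq).mul_one_add hq0 hq using 2 with r n
  · field_simp
    ring
  · split_ifs with hn
    · simp [hn, add_comm]
    · field_simp
      ring

/-! ### Infinite products -/

theorem not_isOfFinOrder_of_norm_lt_one {q : ℂ} (hq1 : ‖q‖ < 1) : ¬IsOfFinOrder q :=
  fun h => hq1.ne h.norm_eq_one

theorem norm_sq_lt_one {q : ℂ} (hq1 : ‖q‖ < 1) : ‖q ^ 2‖ < 1 := by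
  rw [norm_pow]; exact pow_lt_one₀ (norm_nonneg q) hq1 two_ne_zero

theorem norm_pow_mul_le {q : ℂ} (hq1 : ‖q‖ < 1) (x : ℂ) (n : ℕ) : ‖q ^ n * x‖ ≤ ‖x‖ := by
  rw [norm_mul, norm_pow]
  exact mul_le_of_le_one_left (norm_nonneg x) (pow_le_one₀ (norm_nonneg q) hq1.le)

theorem one_sub_pow_mul_ne_zero {x q : ℂ} (hq1 : ‖q‖ < 1) (hx : ‖x‖ < 1) (i : ℕ) :
    1 - q ^ i * x ≠ 0 := fun h => by
  have hlt := (norm_pow_mul_le hq1 x i).trans_lt hx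
  rw [← sub_eq_zero.mp h, norm_one] at hlt
  exact lt_irrefl 1 hlt

theorem one_add_pow_ne_zero {q : ℂ} (hq1 : ‖q‖ < 1) {n : ℕ} (hn : n ≠ 0) : 1 + q ^ n ≠ 0 :=
  fun h => one_sub_pow_ne_zero (not_isOfFinOrder_of_norm_lt_one (norm_sq_lt_one hq1)) hn <| by
    linear_combination (1 - q ^ n) * h

theorem tendsto_qPoch (x : ℂ) {q : ℂ} (hq1 : ‖q‖ < 1) :
    Tendsto (qPoch x q) atTop (𝓝 (qPochInf x q)) :=
  (multipliable_qPochInf x q hq1).hasProd.tendsto_prod_nat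

theorem qPochInf_ne_zero {x q : ℂ} (hq1 : ‖q‖ < 1) (hx : ∀ i : ℕ, 1 - q ^ i * x ≠ 0) :
    qPochInf x q ≠ 0 := by
  simp only [qPochInf, sub_eq_add_neg] at hx ⊢
  refine tprod_one_add_ne_zero_of_summable hx ?_
  simpa [norm_mul, norm_pow] using
    (summable_geometric_of_lt_one (norm_nonneg q) hq1).mul_right ‖x‖

theorem exists_norm_qPoch_le (x : ℂ) {q : ℂ} (hq1 : ‖q‖ < 1) :
    ∃ C, 0 < C ∧ ∀ n, ‖qPoch x q n‖ ≤ C := by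
  obtain ⟨C, hC, h⟩ :=
    (Metric.isBounded_range_of_tendsto _ (tendsto_qPoch x hq1)).exists_pos_norm_le
  exact ⟨C, hC, fun n => h _ ⟨n, rfl⟩⟩

theorem exists_norm_inv_qPoch_le {x q : ℂ} (hq1 : ‖q‖ < 1) (hx : ∀ i : ℕ, 1 - q ^ i * x ≠ 0) :
    ∃ C, 0 < C ∧ ∀ n, ‖(qPoch x q n)⁻¹‖ ≤ C := by
  obtain ⟨C, hC, h⟩ := (Metric.isBounded_range_of_tendsto _
    ((tendsto_qPoch x hq1).inv₀ (qPochInf_ne_zero hq1 hx))).exists_pos_norm_le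
  exact ⟨C, hC, fun n => h _ ⟨n, rfl⟩⟩

theorem qPochInf_eq_qPoch_mul (x : ℂ) {q : ℂ} (hq1 : ‖q‖ < 1) (n : ℕ) :
    qPochInf x q = qPoch x q n * qPochInf (q ^ n * x) q := by
  have hshift : Tendsto (fun m => qPoch x q (n + m)) atTop (𝓝 (qPochInf x q)) := by
    simpa only [add_comm n] using (tendsto_add_atTop_iff_nat n).mpr (tendsto_qPoch x hq1)
  refine tendsto_nhds_unique hshift ?_
  simpa only [qPoch_add] using (tendsto_qPoch (q ^ n * x) hq1).const_mul (qPoch x q n)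

theorem qPochInf_eq_even_mul_odd (x : ℂ) {q : ℂ} (hq1 : ‖q‖ < 1) :
    qPochInf x q = qPochInf x (q ^ 2) * qPochInf (q * x) (q ^ 2) := by
  have heven : Tendsto (fun m => qPoch x q (2 * m)) atTop (𝓝 (qPochInf x q)) :=
    (tendsto_qPoch x hq1).comp (tendsto_id.const_mul_atTop' two_pos)
  refine tendsto_nhds_unique heven ?_
  simpa only [qPoch_two_mul] using (tendsto_qPoch x (norm_sq_lt_one hq1)).mul
    (tendsto_qPoch (q * x) (norm_sq_lt_one hq1))

theorem qPochInf_mul_neg (x : ℂ) {q : ℂ} (hq1 : ‖q‖ < 1) :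
    qPochInf x q * qPochInf (-x) q = qPochInf (x ^ 2) (q ^ 2) := by
  refine tendsto_nhds_unique ?_ (tendsto_qPoch _ (norm_sq_lt_one hq1))
  simpa only [qPoch_mul_neg] using (tendsto_qPoch x hq1).mul (tendsto_qPoch (-x) hq1)

theorem qPochInf_neg_self_mul {q : ℂ} (hq1 : ‖q‖ < 1) :
    qPochInf (-q) q * qPochInf q (q ^ 2) = 1 := by
  have hQ := norm_sq_lt_one hq1
  have hmul := qPochInf_mul_neg q hq1
  rw [qPochInf_eq_even_mul_odd q hq1, ← pow_two] at hmul
  refine mul_right_cancel₀ (qPochInf_ne_zero hQ (one_sub_pow_mul_ne_zero hQ hQ)) ?_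
  linear_combination hmul

theorem Jbar_one_four_mul_qPochInf {q : ℂ} (hq0 : q ≠ 0) (hq1 : ‖q‖ < 1) :
    Jbar 1 4 q * qPochInf q (q ^ 2) = qPochInf q q * qPochInf (-q) q := by
  have hQ := norm_sq_lt_one hq1
  have hneg : qPochInf (-q) (q ^ 2) = qPochInf (-q) (q ^ 4) * qPochInf (q ^ 4 / -q) (q ^ 4) := by
    rw [qPochInf_eq_even_mul_odd (-q) hQ, ← pow_mul, show q ^ 4 / -q = q ^ 2 * -q by field_simp]
  have hsq : qPochInf (q ^ 4) (q ^ 4) = qPochInf (q ^ 2) (q ^ 2) * qPochInf (-q ^ 2) (q ^ 2) := by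
    rw [qPochInf_mul_neg (q ^ 2) hQ, ← pow_mul]
  rw [Jbar, jTheta, zpow_one, ← hneg, hsq, qPochInf_eq_even_mul_odd (-q) hq1,
    qPochInf_eq_even_mul_odd q hq1, ← pow_two, show q * -q = -q ^ 2 by ring]
  ring

theorem J_one_two_eq {q : ℂ} (hq0 : q ≠ 0) :
    J 1 2 q = qPochInf q (q ^ 2) ^ 2 * qPochInf (q ^ 2) (q ^ 2) := by
  rw [J, jTheta, zpow_one, show q ^ 2 / q = q by field_simp, pow_two (qPochInf q (q ^ 2))]

/-! ### The `q`-Gauss summation -/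

/-- The `n`-th term of the basic hypergeometric series `₂φ₁(a, b; abz; q, z)`, whose bottom
parameter is tied to `z` so that the series is summable by the `q`-Gauss theorem. -/
noncomputable def gaussTerm (a b q z : ℂ) (n : ℕ) : ℂ :=
  qPoch a q n * qPoch b q n * z ^ n * (qPoch q q n)⁻¹ * (qPoch (a * b * z) q n)⁻¹

theorem inv_qPoch_eq_mul {x q : ℂ} {n : ℕ} (h : 1 - q ^ n * x ≠ 0) :
    (qPoch x q n)⁻¹ = (1 - q ^ n * x) * (qPoch x q (n + 1))⁻¹ := by
  rw [qPoch_succ, mul_inv, mul_left_comm, mul_inv_cancel₀ h, mul_one]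

section Gauss

variable {a b q z : ℂ}

theorem gaussTerm_telescope (hq1 : ‖q‖ < 1) (hc : ∀ i : ℕ, 1 - q ^ i * (a * b * z) ≠ 0) (n : ℕ) :
    (1 - z) * (1 - a * b * z) * gaussTerm a b q z n -
        (1 - a * z) * (1 - b * z) * gaussTerm a b q (q * z) n =
      (1 - a * b * z) * (1 - q ^ n) * gaussTerm a b q z n -
        (1 - a * b * z) * (1 - q ^ (n + 1)) * gaussTerm a b q z (n + 1) := by
  have h0 : 1 - a * b * z ≠ 0 := by simpa using hc 0
  have hshift : (qPoch (a * b * (q * z)) q n)⁻¹ =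
      (1 - a * b * z) * (qPoch (a * b * z) q (n + 1))⁻¹ := by
    rw [add_comm n 1, qPoch_add, show a * b * (q * z) = q ^ 1 * (a * b * z) by ring, mul_inv]
    simp [qPoch, h0]
  simp only [gaussTerm, hshift, inv_qPoch_eq_mul (hc n),
    inv_qPoch_eq_mul (one_sub_pow_mul_ne_zero hq1 hq1 n), qPoch_succ a, qPoch_succ b]
  ring

theorem exists_norm_gaussTerm_le (hq1 : ‖q‖ < 1)
    (hc : ∀ i : ℕ, 1 - q ^ i * (a * b * z) ≠ 0) :
    ∃ C, 0 < C ∧ ∀ N n, ‖gaussTerm a b q (q ^ N * z) n‖ ≤ C * ‖q ^ N * z‖ ^ n := by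
  obtain ⟨A, hA, hA'⟩ := exists_norm_qPoch_le a hq1
  obtain ⟨B, hB, hB'⟩ := exists_norm_qPoch_le b hq1
  obtain ⟨D, hD, hD'⟩ := exists_norm_qPoch_le (a * b * z) hq1
  obtain ⟨E, hE, hE'⟩ := exists_norm_inv_qPoch_le hq1 hc
  obtain ⟨F, hF, hF'⟩ := exists_norm_inv_qPoch_le hq1 (one_sub_pow_mul_ne_zero hq1 hq1)
  refine ⟨A * B * F * (D * E), by positivity, fun N n => ?_⟩
  have hden : (qPoch (a * b * (q ^ N * z)) q n)⁻¹ =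
      qPoch (a * b * z) q N * (qPoch (a * b * z) q (N + n))⁻¹ := by
    rw [qPoch_add, mul_left_comm (a * b) (q ^ N) z, mul_inv,
      mul_inv_cancel_left₀ (qPoch_ne_zero hc N)]
  rw [gaussTerm, hden, norm_mul, norm_mul, norm_mul, norm_mul, norm_mul, norm_pow]
  calc _ ≤ A * B * ‖q ^ N * z‖ ^ n * F * (D * E) := by
        gcongr
        exacts [hA' n, hB' n, hF' n, hD' N, hE' _]
    _ = _ := by ring

theorem summable_gaussTerm (hq1 : ‖q‖ < 1) (hz : ‖z‖ < 1)
    (hc : ∀ i : ℕ, 1 - q ^ i * (a * b * z) ≠ 0) : Summable (gaussTerm a b q z) := by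
  obtain ⟨C, -, hC⟩ := exists_norm_gaussTerm_le hq1 hc
  refine Summable.of_norm_bounded
    ((summable_geometric_of_lt_one (norm_nonneg z) hz).mul_left C) fun n => ?_
  simpa only [pow_zero, one_mul] using hC 0 n

theorem tsum_gaussTerm_step (hq1 : ‖q‖ < 1) (hz : ‖z‖ < 1)
    (hc : ∀ i : ℕ, 1 - q ^ i * (a * b * z) ≠ 0) :
    (1 - z) * (1 - a * b * z) * ∑' n, gaussTerm a b q z n =
      (1 - a * z) * (1 - b * z) * ∑' n, gaussTerm a b q (q * z) n := by
  have hs := summable_gaussTerm hq1 hz hc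
  have hs' : Summable (gaussTerm a b q (q * z)) :=
    summable_gaussTerm hq1 ((by simpa using norm_pow_mul_le hq1 z 1 : ‖q * z‖ ≤ ‖z‖).trans_lt hz)
      fun i => by simpa only [pow_succ, mul_assoc, mul_left_comm] using hc (i + 1)
  have hdiff := ((hs.hasSum.mul_left ((1 - z) * (1 - a * b * z))).sub
    (hs'.hasSum.mul_left ((1 - a * z) * (1 - b * z)))).tendsto_sum_nat
  simp only [gaussTerm_telescope hq1 hc] at hdiff
  simp only [Finset.sum_range_sub' fun n => (1 - a * b * z) * (1 - q ^ n) * gaussTerm a b q z n]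
    at hdiff
  have hlim := ((((tendsto_pow_atTop_nhds_zero_of_norm_lt_one hq1).const_sub 1).const_mul
    (1 - a * b * z)).mul hs.tendsto_atTop_zero).const_sub
      ((1 - a * b * z) * (1 - q ^ 0) * gaussTerm a b q z 0)
  refine sub_eq_zero.mp ((tendsto_nhds_unique hdiff hlim).trans ?_)
  ring

theorem tsum_gaussTerm_iterate (hq1 : ‖q‖ < 1) (hz : ‖z‖ < 1)
    (hc : ∀ i : ℕ, 1 - q ^ i * (a * b * z) ≠ 0) (N : ℕ) :
    qPoch z q N * qPoch (a * b * z) q N * ∑' n, gaussTerm a b q z n =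
      qPoch (a * z) q N * qPoch (b * z) q N * ∑' n, gaussTerm a b q (q ^ N * z) n := by
  induction N with
  | zero => simp [qPoch_zero]
  | succ N ih =>
    have hstep := tsum_gaussTerm_step (a := a) (b := b) hq1 ((norm_pow_mul_le hq1 z N).trans_lt hz)
      fun i => by
        rw [mul_left_comm (a * b), ← mul_assoc, ← pow_add]; exact hc (i + N)
    rw [← mul_assoc q, ← pow_succ'] at hstep
    simp only [qPoch_succ]
    linear_combination (1 - q ^ N * z) * (1 - q ^ N * (a * b * z)) * ih +
      qPoch (a * z) q N * qPoch (b * z) q N * hstep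

theorem tendsto_tsum_gaussTerm (hq1 : ‖q‖ < 1) (hz : ‖z‖ < 1)
    (hc : ∀ i : ℕ, 1 - q ^ i * (a * b * z) ≠ 0) :
    Tendsto (fun N => ∑' n, gaussTerm a b q (q ^ N * z) n) atTop (𝓝 1) := by
  obtain ⟨C, hC0, hC⟩ := exists_norm_gaussTerm_le hq1 hc
  have hpow : Tendsto (fun N => q ^ N * z) atTop (𝓝 0) := by
    simpa using (tendsto_pow_atTop_nhds_zero_of_norm_lt_one hq1).mul_const z
  rw [← tsum_ite_eq (0 : ℕ) fun _ => (1 : ℂ)]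
  refine tendsto_tsum_of_dominated_convergence (bound := fun n => C * ‖z‖ ^ n)
    ((summable_geometric_of_lt_one (norm_nonneg z) hz).mul_left C) (fun n => ?_)
    (Eventually.of_forall fun N n => ?_)
  · rcases n with _ | n
    · simp [gaussTerm, qPoch_zero]
    · rw [if_neg n.succ_ne_zero]
      refine squeeze_zero_norm (fun N => hC N (n + 1)) ?_
      simpa using (hpow.norm.pow (n + 1)).const_mul C
  · refine (hC N n).trans ?_
    gcongr
    exact norm_pow_mul_le hq1 z N

theorem hasSum_gaussTerm (hq1 : ‖q‖ < 1) (hz : ‖z‖ < 1)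
    (hc : ∀ i : ℕ, 1 - q ^ i * (a * b * z) ≠ 0) :
    HasSum (gaussTerm a b q z)
      (qPochInf (a * z) q * qPochInf (b * z) q / (qPochInf (a * b * z) q * qPochInf z q)) := by
  have hleft := ((tendsto_qPoch z hq1).mul (tendsto_qPoch (a * b * z) hq1)).mul_const
    (∑' n, gaussTerm a b q z n)
  have hright := ((tendsto_qPoch (a * z) hq1).mul (tendsto_qPoch (b * z) hq1)).mul
    (tendsto_tsum_gaussTerm hq1 hz hc)
  simp only [tsum_gaussTerm_iterate hq1 hz hc] at hleft
  have hne := mul_ne_zero (qPochInf_ne_zero hq1 hc)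
    (qPochInf_ne_zero hq1 (one_sub_pow_mul_ne_zero hq1 hz))
  rw [(summable_gaussTerm hq1 hz hc).hasSum_iff, eq_div_iff hne]
  linear_combination tendsto_nhds_unique hleft hright

end Gauss

theorem hasSum_mul_baileyKernel {A B q z : ℂ} (hq1 : ‖q‖ < 1) (hz : ‖z‖ < 1)
    (hABz : A * B * z = q ^ 2) (r : ℕ) :
    HasSum (fun n => qPoch A q n * qPoch B q n * z ^ n * baileyKernel q n r)
      (qPoch A q r * qPoch B q r * z ^ r * qPochInf (q ^ r * (A * z)) q *
        qPochInf (q ^ r * (B * z)) q / (qPochInf q q * qPochInf z q)) := by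
  have hbot : q ^ r * A * (q ^ r * B) * z = q ^ (2 * r + 1) * q := by
    linear_combination q ^ r * q ^ r * hABz
  have hc (i : ℕ) : 1 - q ^ i * (q ^ r * A * (q ^ r * B) * z) ≠ 0 := by
    rw [hbot, ← mul_assoc, ← pow_add]
    exact one_sub_pow_mul_ne_zero hq1 hq1 _
  have hshift (m : ℕ) : qPoch A q (m + r) * qPoch B q (m + r) * z ^ (m + r) *
      baileyKernel q (m + r) r = qPoch A q r * qPoch B q r * z ^ r *
        (qPoch q q (2 * r + 1))⁻¹ * gaussTerm (q ^ r * A) (q ^ r * B) q z m := by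
    have h₁ : ((m + r : ℕ) : ℤ) - r = m := by simp
    have h₂ : ((m + r : ℕ) : ℤ) + r + 1 = (2 * r + 1 + m : ℕ) := by push_cast; ring
    rw [gaussTerm, baileyKernel, hbot, h₁, h₂, add_comm m r, qPochInv_natCast, qPochInv_natCast,
      qPoch_add, qPoch_add, qPoch_add q q (2 * r + 1), mul_inv]
    ring
  rw [← hasSum_nat_add_iff' r, Finset.sum_eq_zero fun n hn => by
    rw [baileyKernel_of_lt q (Finset.mem_range.mp hn), mul_zero], sub_zero]
  simp only [hshift]
  refine Eq.subst (motive := fun s => HasSum _ s) (Eq.symm ?_)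
    ((hasSum_gaussTerm hq1 hz hc).mul_left _)
  rw [hbot, qPochInf_eq_qPoch_mul q hq1 (2 * r + 1), ← mul_assoc (q ^ r), ← mul_assoc (q ^ r)]
  simp only [div_eq_mul_inv, mul_inv]
  ring

/-! ### The Bailey transform -/

theorem hasSum_bailey_transform {R : Type*} [NormedCommRing R] [CompleteSpace R]
    {K : ℕ → ℕ → R} {C : ℝ} (hK : ∀ n r, ‖K n r‖ ≤ C) {δ α β γ : ℕ → R}
    (hδ : Summable fun n => ‖δ n‖) (hα : Summable fun r => ‖α r‖)
    (hβ : ∀ n, HasSum (fun r => α r * K n r) (β n))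
    (hγ : ∀ r, HasSum (fun n => δ n * K n r) (γ r)) :
    HasSum (fun r => α r * γ r) (∑' n, δ n * β n) := by
  have hF : Summable fun p : ℕ × ℕ => δ p.1 * (α p.2 * K p.1 p.2) := by
    refine Summable.of_norm_bounded
      ((hδ.mul_of_nonneg hα (fun _ => norm_nonneg _) (fun _ => norm_nonneg _)).mul_right C)
      fun p => (norm_mul_le _ _).trans ?_
    rw [mul_assoc]
    gcongr
    exact (norm_mul_le _ _).trans (by gcongr; exact hK _ _)
  have hrows : HasSum (fun n => δ n * β n) (∑' p : ℕ × ℕ, δ p.1 * (α p.2 * K p.1 p.2)) :=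
    hF.hasSum.prod_fiberwise fun n => (hβ n).mul_left (δ n)
  have hcols : HasSum (fun r => α r * γ r) (∑' p : ℕ × ℕ, δ p.1 * (α p.2 * K p.1 p.2)) := by
    refine HasSum.prod_fiberwise ((Equiv.prodComm ℕ ℕ).hasSum_iff.mpr hF.hasSum) fun r => ?_
    simpa only [Function.comp_apply, Equiv.prodComm_apply, Prod.swap, mul_left_comm] using
      (hγ r).mul_left (α r)
  exact hrows.tsum_eq ▸ hcols

theorem exists_norm_baileyKernel_le {q : ℂ} (hq1 : ‖q‖ < 1) :
    ∃ C, ∀ n r, ‖baileyKernel q n r‖ ≤ C := by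
  obtain ⟨C, hC, h⟩ := exists_norm_inv_qPoch_le hq1 (one_sub_pow_mul_ne_zero hq1 hq1)
  have hinv (k : ℤ) : ‖qPochInv q k‖ ≤ C := by
    rw [qPochInv]
    split_ifs
    · exact h _
    · simpa only [norm_zero] using hC.le
  refine ⟨C * C, fun n r => ?_⟩
  rw [baileyKernel, norm_mul]
  exact mul_le_mul (hinv _) (hinv _) (norm_nonneg _) hC.le

theorem IsBaileyPair.hasSum {q : ℂ} {α β : ℕ → ℂ} (h : IsBaileyPair q α β) (n : ℕ) :
    HasSum (fun r => α r * baileyKernel q n r) (β n) := by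
  rw [← h n]
  refine hasSum_sum_of_ne_finset_zero fun r hr => ?_
  rw [baileyKernel_of_lt q (by simpa using hr), mul_zero]

theorem summable_norm_qPoch_mul_qPoch_mul_pow (A B : ℂ) {q z : ℂ} (hq1 : ‖q‖ < 1) (hz : ‖z‖ < 1) :
    Summable fun n => ‖qPoch A q n * qPoch B q n * z ^ n‖ := by
  obtain ⟨C, hC, h⟩ := exists_norm_qPoch_le A hq1
  obtain ⟨D, -, h'⟩ := exists_norm_qPoch_le B hq1
  refine Summable.of_nonneg_of_le (fun _ => norm_nonneg _) (fun n => ?_)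
    ((summable_geometric_of_lt_one (norm_nonneg z) hz).mul_left (C * D))
  rw [norm_mul, norm_mul, norm_pow]
  gcongr
  exacts [h n, h' n]

theorem hasSum_Jbar_mul_baileyKernel {q : ℂ} (hq0 : q ≠ 0) (hq1 : ‖q‖ < 1) (r : ℕ) :
    HasSum (fun n => Jbar 1 4 q * (qPoch q (q ^ 2) n * (-q) ^ n) * baileyKernel q n r)
      ((-q) ^ r / (1 - q ^ (2 * r + 1))) := by
  obtain ⟨p, hp⟩ := IsAlgClosed.exists_pow_nat_eq q two_pos
  have hz : ‖-q‖ < 1 := by rwa [norm_neg]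
  have hγ := (hasSum_mul_baileyKernel (A := p) (B := -p) hq1 hz (by rw [← hp]; ring) r).mul_left
    (Jbar 1 4 q)
  simp only [qPoch_mul_neg, hp, ← mul_assoc (Jbar 1 4 q)] at hγ ⊢
  refine Eq.subst (motive := fun s => HasSum _ s) (Eq.symm ?_) hγ
  have hprod : qPochInf (q ^ r * (p * -q)) q * qPochInf (q ^ r * (-p * -q)) q =
      qPochInf ((q ^ 2) ^ (r + 1) * q) (q ^ 2) := by
    rw [neg_mul p, mul_neg (q ^ r), qPochInf_mul_neg _ hq1, ← hp]
    ring_nf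
  have hJ := Jbar_one_four_mul_qPochInf hq0 hq1
  rw [qPochInf_eq_qPoch_mul q (norm_sq_lt_one hq1) (r + 1), qPoch_succ, ← hprod] at hJ
  rw [mul_div_assoc', eq_div_iff (mul_ne_zero
      (qPochInf_ne_zero hq1 (one_sub_pow_mul_ne_zero hq1 hq1))
      (qPochInf_ne_zero hq1 (one_sub_pow_mul_ne_zero hq1 hz))), div_mul_eq_mul_div,
    div_eq_iff (one_sub_pow_ne_zero (not_isOfFinOrder_of_norm_lt_one hq1)
      (Nat.add_one_ne_zero (2 * r)))]
  linear_combination -(-q) ^ r * hJ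

theorem hasSum_J_mul_baileyKernel {q : ℂ} (hq0 : q ≠ 0) (hq1 : ‖q‖ < 1) (r : ℕ) :
    HasSum (fun n => J 1 2 q * (qPoch (-q) q (2 * n) * q ^ n) * baileyKernel (q ^ 2) n r)
      (q ^ r / (1 + q ^ (2 * r + 1))) := by
  have hQ := norm_sq_lt_one hq1
  have hγ := (hasSum_mul_baileyKernel (A := -q) (B := q * -q) hQ hq1 (by ring) r).mul_left
    (J 1 2 q)
  simp only [← qPoch_two_mul, ← mul_assoc (J 1 2 q)] at hγ ⊢
  refine Eq.subst (motive := fun s => HasSum _ s) (Eq.symm ?_) hγ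
  have hone := qPochInf_neg_self_mul hq1
  rw [qPochInf_eq_even_mul_odd _ hq1, qPochInf_eq_qPoch_mul (-q) hQ (r + 1),
    qPochInf_eq_qPoch_mul (q * -q) hQ r, qPoch_succ,
    show (q ^ 2) ^ (r + 1) * -q = (q ^ 2) ^ r * (q * -q * q) by ring, mul_neg q q,
    ← neg_mul] at hone
  rw [J_one_two_eq hq0, qPoch_two_mul, mul_neg q q, ← neg_mul, mul_div_assoc',
    eq_div_iff (mul_ne_zero (qPochInf_ne_zero hQ (one_sub_pow_mul_ne_zero hQ hQ))
      (qPochInf_ne_zero hQ (one_sub_pow_mul_ne_zero hQ hq1))), div_mul_eq_mul_div,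
    div_eq_iff (one_add_pow_ne_zero hq1 (Nat.add_one_ne_zero (2 * r)))]
  linear_combination (-q ^ r * qPochInf q (q ^ 2) * qPochInf (q ^ 2) (q ^ 2)) * hone

theorem IsBaileyPair.hasSum_Jbar {q : ℂ} (hq0 : q ≠ 0) (hq1 : ‖q‖ < 1) {α β : ℕ → ℂ}
    (h : IsBaileyPair q α β) (hα : Summable fun r => ‖α r‖) :
    HasSum (fun r => α r * ((-q) ^ r / (1 - q ^ (2 * r + 1))))
      (Jbar 1 4 q * ∑' n, qPoch q (q ^ 2) n * (-q) ^ n * β n) := by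
  obtain ⟨C, hC⟩ := exists_norm_baileyKernel_le hq1
  obtain ⟨p, hp⟩ := IsAlgClosed.exists_pow_nat_eq q two_pos
  have hδ := summable_norm_qPoch_mul_qPoch_mul_pow p (-p) hq1 (by rwa [norm_neg] : ‖-q‖ < 1)
  simp only [qPoch_mul_neg, hp] at hδ
  simpa only [mul_assoc, tsum_mul_left] using hasSum_bailey_transform hC
    (hδ.of_norm.mul_left (Jbar 1 4 q)).norm hα h.hasSum (hasSum_Jbar_mul_baileyKernel hq0 hq1)

theorem IsBaileyPair.hasSum_J {q : ℂ} (hq0 : q ≠ 0) (hq1 : ‖q‖ < 1) {α β : ℕ → ℂ}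
    (h : IsBaileyPair (q ^ 2) α β) (hα : Summable fun r => ‖α r‖) :
    HasSum (fun r => α r * (q ^ r / (1 + q ^ (2 * r + 1))))
      (J 1 2 q * ∑' n, qPoch (-q) q (2 * n) * q ^ n * β n) := by
  have hQ := norm_sq_lt_one hq1
  obtain ⟨C, hC⟩ := exists_norm_baileyKernel_le hQ
  have hδ := summable_norm_qPoch_mul_qPoch_mul_pow (-q) (q * -q) hQ hq1
  simp only [← qPoch_two_mul] at hδ
  simpa only [mul_assoc, tsum_mul_left] using hasSum_bailey_transform hC
    (hδ.of_norm.mul_left (J 1 2 q)).norm hα h.hasSum (hasSum_J_mul_baileyKernel hq0 hq1)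

/-! ### Fine's transformation -/

/-- The series `∑ (x; q)_n t^n`. -/
noncomputable def fineSum (x q t : ℂ) : ℂ := ∑' n, qPoch x q n * t ^ n

theorem exists_norm_qPoch_mul_pow_le (x : ℂ) {q : ℂ} (hq1 : ‖q‖ < 1) :
    ∃ C, 0 < C ∧ ∀ t n, ‖qPoch x q n * t ^ n‖ ≤ C * ‖t‖ ^ n := by
  obtain ⟨C, hC, h⟩ := exists_norm_qPoch_le x hq1
  refine ⟨C, hC, fun t n => ?_⟩
  rw [norm_mul, norm_pow]
  gcongr
  exact h n

theorem hasSum_qPoch_mul_pow (x : ℂ) {q t : ℂ} (hq1 : ‖q‖ < 1) (ht : ‖t‖ < 1) :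
    HasSum (fun n => qPoch x q n * t ^ n) (fineSum x q t) := by
  obtain ⟨C, -, h⟩ := exists_norm_qPoch_mul_pow_le x hq1
  exact (Summable.of_norm_bounded
    ((summable_geometric_of_lt_one (norm_nonneg t) ht).mul_left C) (h t)).hasSum

theorem one_sub_mul_fineSum (x : ℂ) {q t : ℂ} (hq1 : ‖q‖ < 1) (ht : ‖t‖ < 1) :
    (1 - t) * fineSum x q t = 1 - x * t * fineSum x q (q * t) := by
  have ht' : ‖q * t‖ < 1 := (by simpa using norm_pow_mul_le hq1 t 1 : ‖q * t‖ ≤ ‖t‖).trans_lt ht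
  have h := hasSum_qPoch_mul_pow x hq1 ht
  have htail : HasSum (fun n => qPoch x q (n + 1) * t ^ (n + 1))
      (t * fineSum x q t - x * t * fineSum x q (q * t)) := by
    refine ((h.mul_left t).sub
      ((hasSum_qPoch_mul_pow x hq1 ht').mul_left (x * t))).congr_fun fun n => ?_
    rw [qPoch_succ]
    ring
  have := htail.unique ((hasSum_nat_add_iff' 1).mpr h)
  rw [Finset.sum_range_one, qPoch_zero, pow_zero, mul_one] at this
  linear_combination -this

theorem fineSum_eq_sum_add (x : ℂ) {q t : ℂ} (hq1 : ‖q‖ < 1) (ht : ‖t‖ < 1) (N : ℕ) :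
    fineSum x q t = ∑ n ∈ Finset.range N, (-(x * t)) ^ n * q ^ n.choose 2 / qPoch t q (n + 1) +
      (-(x * t)) ^ N * q ^ N.choose 2 / qPoch t q N * fineSum x q (q ^ N * t) := by
  induction N with
  | zero => simp [qPoch_zero]
  | succ N ih =>
    have h := one_sub_mul_fineSum x hq1 ((norm_pow_mul_le hq1 t N).trans_lt ht)
    rw [← mul_assoc q, ← pow_succ', mul_comm,
      ← eq_div_iff (one_sub_pow_mul_ne_zero hq1 ht N)] at h
    rw [Finset.sum_range_succ, ih, h, qPoch_succ, Nat.choose_succ_succ' N 1, Nat.choose_one_right,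
      pow_add q N, pow_succ (-(x * t)), add_assoc, div_mul_div_comm, div_mul_eq_mul_div, ← add_div]
    ring

theorem summable_pow_mul_pow_choose_two (t : ℂ) {q : ℂ} (hq1 : ‖q‖ < 1) :
    Summable fun n : ℕ => t ^ n * q ^ n.choose 2 := by
  have hratio : Tendsto (fun n : ℕ => ‖t * q ^ n‖) atTop (𝓝 0) := by
    simpa using ((tendsto_pow_atTop_nhds_zero_of_norm_lt_one hq1).const_mul t).norm
  refine summable_of_ratio_norm_eventually_le (r := 1 / 2) (by norm_num) ?_
  filter_upwards [hratio.eventually_le_const (by norm_num : (0 : ℝ) < 1 / 2)] with n hn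
  calc ‖t ^ (n + 1) * q ^ (n + 1).choose 2‖ = ‖t * q ^ n‖ * ‖t ^ n * q ^ n.choose 2‖ := by
        rw [← norm_mul, Nat.choose_succ_succ' n 1, Nat.choose_one_right]; ring_nf
    _ ≤ 1 / 2 * ‖t ^ n * q ^ n.choose 2‖ := by gcongr

theorem hasSum_fineSum (x : ℂ) {q t : ℂ} (hq1 : ‖q‖ < 1) (ht : ‖t‖ < 1) :
    HasSum (fun n => (-(x * t)) ^ n * q ^ n.choose 2 / qPoch t q (n + 1)) (fineSum x q t) := by
  obtain ⟨C, -, hinv⟩ := exists_norm_inv_qPoch_le hq1 (one_sub_pow_mul_ne_zero hq1 ht)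
  obtain ⟨D, hD, hterm⟩ := exists_norm_qPoch_mul_pow_le x hq1
  have htheta := (summable_pow_mul_pow_choose_two (-(x * t)) hq1).norm
  have hsum (k : ℕ → ℕ) :
      Summable fun n => (-(x * t)) ^ n * q ^ n.choose 2 / qPoch t q (k n) := by
    refine Summable.of_norm_bounded (htheta.mul_right C) fun n => ?_
    rw [div_eq_mul_inv, norm_mul]
    gcongr
    exact hinv _
  have hbound (N : ℕ) : ‖fineSum x q (q ^ N * t)‖ ≤ D * (1 - ‖t‖)⁻¹ := by
    refine tsum_of_norm_bounded ((hasSum_geometric_of_lt_one (norm_nonneg t) ht).mul_left D)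
      fun n => (hterm _ n).trans ?_
    gcongr
    exact norm_pow_mul_le hq1 t N
  have hremainder : Tendsto (fun N : ℕ => (-(x * t)) ^ N * q ^ N.choose 2 / qPoch t q N *
      fineSum x q (q ^ N * t)) atTop (𝓝 0) :=
    (hsum fun n => n).tendsto_atTop_zero.zero_mul_isBoundedUnder_le
      (isBoundedUnder_of ⟨_, hbound⟩)
  rw [(hsum fun n => n + 1).hasSum_iff_tendsto_nat, ← sub_zero (fineSum x q t)]
  refine (hremainder.const_sub (fineSum x q t)).congr fun N => ?_
  rw [fineSum_eq_sum_add x hq1 ht N, add_sub_cancel_right]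

theorem two_mul_choose_two_add (n : ℕ) : 2 * n.choose 2 + n = n ^ 2 := by
  induction n with
  | zero => rfl
  | succ n ih =>
    rw [Nat.choose_succ_succ' n 1, Nat.choose_one_right]
    linarith

theorem hasSum_nuTerm {q : ℂ} (hq1 : ‖q‖ < 1) :
    HasSum (nuTerm q) (fineSum q (q ^ 2) (-q)) := by
  refine (hasSum_fineSum q (norm_sq_lt_one hq1) (by rwa [norm_neg])).congr_fun fun n => ?_
  rw [nuTerm, show -(q * -q) = q ^ 2 by ring, ← pow_add, ← pow_mul]
  congr 2
  linarith [two_mul_choose_two_add n]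

theorem hasSum_phiTerm {q : ℂ} (hq1 : ‖q‖ < 1) :
    HasSum (phiTerm q) (1 + q * fineSum q (q ^ 2) (-q ^ 2)) := by
  have hQ := norm_sq_lt_one hq1
  have h := (hasSum_fineSum q hQ (by rwa [norm_neg] : ‖-q ^ 2‖ < 1)).mul_left q
  rw [← hasSum_nat_add_iff' 1, Finset.sum_range_one,
    show phiTerm q 0 = 1 by simp [phiTerm, qPoch_zero], add_sub_cancel_left]
  refine h.congr_fun fun n => ?_
  rw [phiTerm, mul_div_assoc', show -(q * -q ^ 2) = q ^ 3 by ring, ← pow_mul, ← pow_mul, ← pow_add,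
    ← pow_succ']
  congr 2
  linarith [two_mul_choose_two_add n]

/-! ### Hecke-type double sums -/

/-- The common value of `sg m` and `sg n`, or `0` if they differ; it turns sums over pairs of equal
sign into sums over all pairs of integers. -/
def commonSign (m n : ℤ) : ℤ := if sg m = sg n then sg m else 0

theorem commonSign_of_nonneg {m n : ℤ} (hm : 0 ≤ m) (hn : 0 ≤ n) : commonSign m n = 1 := by
  simp only [commonSign, sg, if_pos hm, if_pos hn, if_true]

theorem commonSign_of_neg {m n : ℤ} (hm : m < 0) (hn : n < 0) : commonSign m n = -1 := by
  simp only [commonSign, sg, if_neg hm.not_ge, if_neg hn.not_ge, if_true]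

theorem commonSign_comm (m n : ℤ) : commonSign m n = commonSign n m := by
  grind [commonSign]

theorem commonSign_neg_one_sub (m n : ℤ) : commonSign (-1 - m) (-1 - n) = -commonSign m n := by
  grind [commonSign, sg]

theorem commonSign_two_mul (m n : ℤ) : commonSign (2 * m) (2 * n) = commonSign m n := by
  grind [commonSign, sg]

theorem commonSign_two_mul_add_one (m n : ℤ) :
    commonSign (2 * m + 1) (2 * n + 1) = commonSign m n := by
  grind [commonSign, sg]

/-- The summand of `f_{a,b,c}(x, y, q)` without its sign `sg r`, at an arbitrary pair `(r, s)`. -/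
noncomputable def heckeTerm (a b c : ℤ) (x y q : ℂ) (r s : ℤ) : ℂ :=
  (-1) ^ (r + s) * x ^ r * y ^ s * q ^ (a * chooseTwo r + b * r * s + c * chooseTwo s)

theorem indicator_fTerm (a b c : ℤ) (x y q : ℂ) :
    {p : ℤ × ℤ | sg p.1 = sg p.2}.indicator
        (fun p => (sg p.1 : ℂ) * heckeTerm a b c x y q p.1 p.2) =
      fun p => commonSign p.1 p.2 * heckeTerm a b c x y q p.1 p.2 := by
  ext p
  by_cases h : sg p.1 = sg p.2 <;> simp [commonSign, h]

theorem fTerm_eq (a b c : ℤ) (x y q : ℂ) (p : {p : ℤ × ℤ | sg p.1 = sg p.2}) :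
    fTerm a b c x y q p = (sg p.1.1 : ℂ) * heckeTerm a b c x y q p.1.1 p.1.2 := by
  simp only [fTerm, heckeTerm, chooseTwo, mul_assoc]

theorem f_eq_tsum (a b c : ℤ) (x y q : ℂ) :
    f a b c x y q = ∑' p : ℤ × ℤ, commonSign p.1 p.2 * heckeTerm a b c x y q p.1 p.2 := by
  rw [← indicator_fTerm, ← tsum_subtype]
  exact tsum_congr (fTerm_eq a b c x y q)

theorem f_swap (a b c : ℤ) (x y q : ℂ) : f a b c x y q = f c b a y x q := by
  rw [f_eq_tsum, f_eq_tsum, ← (Equiv.prodComm ℤ ℤ).tsum_eq]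
  refine tsum_congr fun p => ?_
  rw [Equiv.prodComm_apply, Prod.fst_swap, Prod.snd_swap, commonSign_comm, heckeTerm, heckeTerm,
    add_comm p.2, show a * chooseTwo p.2 + b * p.2 * p.1 + c * chooseTwo p.1 =
      c * chooseTwo p.1 + b * p.1 * p.2 + a * chooseTwo p.2 by ring]
  ring

theorem chooseTwo_neg_one_sub (r : ℤ) : chooseTwo (-1 - r) = chooseTwo r + 2 * r + 1 := by
  linarith [two_mul_chooseTwo r, two_mul_chooseTwo (-1 - r)]

theorem heckeTerm_neg_one_sub {x y q : ℂ} (hx : x ≠ 0) (hy : y ≠ 0) (hq0 : q ≠ 0) (a b c r s : ℤ) :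
    heckeTerm a b c x y q (-1 - r) (-1 - s) = q ^ (a + b + c) / (x * y) *
      heckeTerm a b c (q ^ (2 * a + b) / x) (q ^ (2 * c + b) / y) q r s := by
  have hsign : (-1 : ℂ) ^ (-1 - r + (-1 - s)) = (-1) ^ (r + s) := by
    rw [show -1 - r + (-1 - s) = -2 - (r + s) by ring, zpow_sub₀ (by norm_num), div_eq_mul_inv,
      ← inv_zpow, inv_neg_one]
    norm_num
  have hexp : a * chooseTwo (-1 - r) + b * (-1 - r) * (-1 - s) + c * chooseTwo (-1 - s) =
      a + b + c + (2 * a + b) * r + (2 * c + b) * s +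
        (a * chooseTwo r + b * r * s + c * chooseTwo s) := by
    rw [chooseTwo_neg_one_sub, chooseTwo_neg_one_sub]
    ring
  rw [heckeTerm, heckeTerm, hsign, hexp, zpow_add₀ hq0 _ (a * chooseTwo r + b * r * s + _),
    zpow_add₀ hq0 _ ((2 * c + b) * s), zpow_add₀ hq0 _ ((2 * a + b) * r), div_zpow, div_zpow,
    ← zpow_mul, ← zpow_mul, zpow_sub₀ hx, zpow_sub₀ hy, zpow_neg_one, zpow_neg_one]
  field_simp

theorem f_reflect {x y q : ℂ} (hx : x ≠ 0) (hy : y ≠ 0) (hq0 : q ≠ 0) (a b c : ℤ) :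
    f a b c x y q = -(q ^ (a + b + c) / (x * y)) *
      f a b c (q ^ (2 * a + b) / x) (q ^ (2 * c + b) / y) q := by
  rw [f_eq_tsum, f_eq_tsum, ← tsum_mul_left,
    ← ((Equiv.subLeft (-1 : ℤ)).prodCongr (Equiv.subLeft (-1 : ℤ))).tsum_eq]
  refine tsum_congr fun p => ?_
  simp only [Equiv.prodCongr_apply, Prod.map_fst, Prod.map_snd, Equiv.subLeft_apply,
    commonSign_neg_one_sub, heckeTerm_neg_one_sub hx hy hq0, Int.cast_neg]
  ring

theorem chooseTwo_natCast (n : ℕ) : chooseTwo n = n.choose 2 := by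
  have h : (2 * n.choose 2 + n : ℤ) = n ^ 2 := by exact_mod_cast two_mul_choose_two_add n
  linarith [two_mul_chooseTwo n]

theorem summable_zpow_mul_zpow_chooseTwo (x : ℂ) {q : ℂ} (hq1 : ‖q‖ < 1) :
    Summable fun r : ℤ => x ^ r * q ^ chooseTwo r := by
  refine Summable.of_nat_of_neg ?_ ?_
  · simpa only [chooseTwo_natCast, zpow_natCast] using summable_pow_mul_pow_choose_two x hq1
  · refine (summable_pow_mul_pow_choose_two (q * x⁻¹) hq1).congr fun n => ?_
    have hneg : chooseTwo (-n) = (n + n.choose 2 : ℕ) := by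
      push_cast
      linarith [two_mul_chooseTwo n, two_mul_chooseTwo (-n), chooseTwo_natCast n]
    rw [hneg, zpow_natCast, zpow_neg, zpow_natCast, pow_add, mul_pow, inv_pow]
    ring

theorem summable_fTerm {a b c : ℤ} (ha : 0 < a) (hb : 0 ≤ b) (hc : 0 < c) (x y : ℂ) {q : ℂ}
    (hq0 : q ≠ 0) (hq1 : ‖q‖ < 1) : Summable (fTerm a b c x y q) := by
  have hzpow {k : ℤ} (hk : 0 < k) : ‖q ^ k‖ < 1 := by
    rw [norm_zpow]
    exact zpow_lt_one₀ (norm_pos_iff.mpr hq0) hq1 hk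
  have hprod := ((summable_zpow_mul_zpow_chooseTwo x (hzpow ha)).norm.mul_of_nonneg
    (summable_zpow_mul_zpow_chooseTwo y (hzpow hc)).norm (fun _ => norm_nonneg _)
    fun _ => norm_nonneg _).comp_injective
      (Subtype.val_injective (p := fun p : ℤ × ℤ => sg p.1 = sg p.2))
  refine Summable.of_norm_bounded hprod fun ⟨⟨r, s⟩, hrs⟩ => ?_
  have hsg : ‖(sg r : ℂ)‖ = 1 := by rw [sg]; split_ifs <;> simp
  have hcross : ‖q ^ (b * r * s)‖ ≤ 1 := by
    have hrs0 : 0 ≤ r * s := mul_nonneg_iff.mpr (by grind [sg])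
    rw [norm_zpow, mul_assoc]
    exact zpow_le_one₀ (norm_pos_iff.mpr hq0) hq1.le (mul_nonneg hb hrs0)
  rw [fTerm_eq, heckeTerm, zpow_add₀ hq0, zpow_add₀ hq0, zpow_mul, zpow_mul q c]
  simp only [norm_mul, hsg, norm_zpow (-1 : ℂ), norm_neg, norm_one, one_zpow, one_mul,
    Function.comp_apply]
  calc ‖x ^ r‖ * ‖y ^ s‖ *
        (‖(q ^ a) ^ chooseTwo r‖ * ‖q ^ (b * r * s)‖ * ‖(q ^ c) ^ chooseTwo s‖)
      = ‖x ^ r‖ * ‖(q ^ a) ^ chooseTwo r‖ * (‖y ^ s‖ * ‖(q ^ c) ^ chooseTwo s‖) *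
        ‖q ^ (b * r * s)‖ := by ring
    _ ≤ _ := mul_le_of_le_one_right (by positivity) hcross

theorem hasSum_heckeTerm {a b c : ℤ} (ha : 0 < a) (hb : 0 ≤ b) (hc : 0 < c) (x y : ℂ) {q : ℂ}
    (hq0 : q ≠ 0) (hq1 : ‖q‖ < 1) :
    HasSum (fun p : ℤ × ℤ => commonSign p.1 p.2 * heckeTerm a b c x y q p.1 p.2)
      (f a b c x y q) := by
  rw [← indicator_fTerm, ← hasSum_subtype_iff_indicator]
  exact (summable_fTerm ha hb hc x y hq0 hq1).hasSum.congr_fun fun p =>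
    (fTerm_eq a b c x y q p).symm

/-! ### Sums over indefinite cones -/

/-- The pairs `(n, j)` with `|j| ≤ n`. -/
abbrev Cone : Type := {p : ℤ × ℤ // 0 ≤ p.1 + p.2 ∧ 0 ≤ p.1 - p.2}

/-- The pairs `(n, j)` with `|j| ≤ -n - 1`. -/
abbrev NegCone : Type := {p : ℤ × ℤ // p.1 + p.2 < 0 ∧ p.1 - p.2 < 0}

/-- The reflection `n ↦ -1 - n`, which interchanges the two cones. -/
def coneReflection : Cone ≃ NegCone where
  toFun p := ⟨(-1 - p.1.1, p.1.2), by have := p.2; dsimp only; omega⟩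
  invFun p := ⟨(-1 - p.1.1, p.1.2), by have := p.2; dsimp only; omega⟩
  left_inv p := by ext <;> simp
  right_inv p := by ext <;> simp

/-- The cone as a union of the blocks `{n} × [-n, n]`. -/
def sigmaEquivCone : (Σ n : ℕ, {j : ℤ // j ∈ Finset.Icc (-(n : ℤ)) n}) ≃ Cone where
  toFun x := ⟨(x.1, x.2), by have := Finset.mem_Icc.mp x.2.2; dsimp only; omega⟩
  invFun p := ⟨p.1.1.toNat, p.1.2, by have := p.2; rw [Finset.mem_Icc]; omega⟩
  left_inv x := by simp
  right_inv p := by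
    ext
    · exact Int.toNat_of_nonneg (by have := p.2; omega)
    · rfl

theorem hasSum_cone_fiberwise {t : ℤ → ℤ → ℂ} {u : ℂ}
    (h : HasSum (fun p : Cone => t p.1.1 p.1.2) u) :
    HasSum (fun n : ℕ => ∑ j ∈ Finset.Icc (-(n : ℤ)) n, t n j) u :=
  (sigmaEquivCone.hasSum_iff.mpr h).sigma fun n =>
    Finset.hasSum (Finset.Icc (-(n : ℤ)) n) fun j => t n j

theorem HasIndefSum.hasSum_blocks {t : ℤ → ℤ → ℂ} {S : ℂ} (h : HasIndefSum t S) :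
    HasSum (fun n : ℕ => ∑ j ∈ Finset.Icc (-(n : ℤ)) n, (t n j - t (-1 - n) j)) S := by
  obtain ⟨u, v, hu, hv, rfl⟩ := h
  simp only [Finset.sum_sub_distrib]
  have hv' := (coneReflection.hasSum_iff (f := fun p : NegCone => t p.1.1 p.1.2)).mpr hv
  exact (hasSum_cone_fiberwise hu).sub (hasSum_cone_fiberwise (t := fun n j => t (-1 - n) j) hv')

theorem HasIndefSum.unique {t : ℤ → ℤ → ℂ} {S S' : ℂ} (h : HasIndefSum t S)
    (h' : HasIndefSum t S') : S = S' :=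
  h.hasSum_blocks.unique h'.hasSum_blocks

theorem HasIndefSum.congr_fun {t t' : ℤ → ℤ → ℂ} {S : ℂ} (h : HasIndefSum t S)
    (ht : ∀ n j, t' n j = t n j) : HasIndefSum t' S :=
  (funext₂ ht : t' = t) ▸ h

theorem HasIndefSum.comp_neg_right {t : ℤ → ℤ → ℂ} {S : ℂ} (h : HasIndefSum t S) :
    HasIndefSum (fun n j => t n (-j)) S := by
  obtain ⟨u, v, hu, hv, rfl⟩ := h
  let e : ℤ × ℤ ≃ ℤ × ℤ := (Equiv.refl ℤ).prodCongr (Equiv.neg ℤ)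
  let eCone : Cone ≃ Cone := e.subtypeEquiv fun p => by
    simp only [e, Equiv.prodCongr_apply, Prod.map, Equiv.refl_apply, Equiv.neg_apply]; omega
  let eNegCone : NegCone ≃ NegCone := e.subtypeEquiv fun p => by
    simp only [e, Equiv.prodCongr_apply, Prod.map, Equiv.refl_apply, Equiv.neg_apply]; omega
  exact ⟨u, v, (eCone.hasSum_iff (f := fun p : Cone => t p.1.1 p.1.2)).mpr hu,
    (eNegCone.hasSum_iff (f := fun p : NegCone => t p.1.1 p.1.2)).mpr hv, rfl⟩

theorem hasIndefSum_of_hasSum {t : ℤ → ℤ → ℂ} {S : ℂ}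
    (h : HasSum (fun p : ℤ × ℤ => commonSign (p.1 + p.2) (p.1 - p.2) * t p.1 p.2) S) :
    HasIndefSum t S := by
  let A : Set (ℤ × ℤ) := {p | 0 ≤ p.1 + p.2 ∧ 0 ≤ p.1 - p.2}
  let B : Set (ℤ × ℤ) := {p | p.1 + p.2 < 0 ∧ p.1 - p.2 < 0}
  let T (p : ℤ × ℤ) : ℂ := t p.1 p.2
  have hsplit (p : ℤ × ℤ) : commonSign (p.1 + p.2) (p.1 - p.2) * t p.1 p.2 =
      A.indicator T p - B.indicator T p := by
    by_cases hA : p ∈ A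
    · have hB : p ∉ B := fun hB => hA.1.not_gt hB.1
      rw [commonSign_of_nonneg hA.1 hA.2, Set.indicator_of_mem hA, Set.indicator_of_notMem hB,
        Int.cast_one, one_mul, sub_zero]
    by_cases hB : p ∈ B
    · rw [commonSign_of_neg hB.1 hB.2, Set.indicator_of_notMem hA, Set.indicator_of_mem hB,
        Int.cast_neg, Int.cast_one, neg_one_mul, zero_sub]
    · have hzero : commonSign (p.1 + p.2) (p.1 - p.2) = 0 := by
        simp only [A, B, Set.mem_ofPred_eq] at hA hB
        grind [commonSign, sg]
      rw [hzero, Set.indicator_of_notMem hA, Set.indicator_of_notMem hB, Int.cast_zero, zero_mul,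
        sub_zero]
  have hA : Summable (T ∘ (↑) : A → ℂ) := (h.summable.subtype A).congr fun ⟨p, hp⟩ => by
    simp only [Function.comp_apply, T, commonSign_of_nonneg hp.1 hp.2, Int.cast_one, one_mul]
  have hB : Summable (T ∘ (↑) : B → ℂ) := (h.summable.subtype B).neg.congr fun ⟨p, hp⟩ => by
    simp only [Function.comp_apply, T, commonSign_of_neg hp.1 hp.2, Int.cast_neg, Int.cast_one,
      neg_one_mul, neg_neg]
  refine ⟨_, _, hA.hasSum, hB.hasSum, h.unique ?_⟩
  simp only [hsplit]
  exact (hasSum_subtype_iff_indicator.mp hA.hasSum).sub (hasSum_subtype_iff_indicator.mp hB.hasSum)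

/-- The pairs `(n, j)` split according to the parity of `n + j`: `n - j` and `n + j` are `2r` and
`2s` on the first copy of `ℤ × ℤ`, and `2r + 1` and `2s + 1` on the second. -/
def parityEquiv : (ℤ × ℤ) ⊕ (ℤ × ℤ) ≃ ℤ × ℤ where
  toFun := Sum.elim (fun p => (p.1 + p.2, p.2 - p.1)) fun p => (p.1 + p.2 + 1, p.2 - p.1)
  invFun p := if Even (p.1 + p.2) then .inl ((p.1 - p.2) / 2, (p.1 + p.2) / 2)
    else .inr ((p.1 - p.2) / 2, (p.1 + p.2) / 2)
  left_inv := by rintro (p | p) <;> grind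
  right_inv p := by grind

theorem hasIndefSum_of_parity {t : ℤ → ℤ → ℂ} {A B : ℂ}
    (hA : HasSum (fun p : ℤ × ℤ => commonSign p.1 p.2 * t (p.1 + p.2) (p.2 - p.1)) A)
    (hB : HasSum (fun p : ℤ × ℤ => commonSign p.1 p.2 * t (p.1 + p.2 + 1) (p.2 - p.1)) B) :
    HasIndefSum t (A + B) := by
  refine hasIndefSum_of_hasSum (parityEquiv.hasSum_iff.mp (HasSum.sum ?_ ?_))
  · refine hA.congr_fun fun p => ?_
    rw [← commonSign_two_mul, commonSign_comm]
    simp only [parityEquiv, Function.comp_apply, Equiv.coe_fn_mk, Sum.elim_inl]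
    ring_nf
  · refine hB.congr_fun fun p => ?_
    rw [← commonSign_two_mul_add_one, commonSign_comm]
    simp only [parityEquiv, Function.comp_apply, Equiv.coe_fn_mk, Sum.elim_inr]
    ring_nf

/-- The Hecke-type term `(-1)^j w^n q^{2n² - 3j²/2 + j/2}`; the division is exact. -/
noncomputable def indefThetaTerm (w q : ℂ) (n j : ℤ) : ℂ :=
  (-1) ^ j * w ^ n * q ^ (2 * n ^ 2 - j * (3 * j - 1) / 2)

theorem pentagonal_exponent_eq (j : ℤ) : j * (3 * j - 1) / 2 = j ^ 2 + chooseTwo j :=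
  Int.ediv_eq_of_eq_mul_right two_ne_zero <| by linear_combination -two_mul_chooseTwo j

theorem indefThetaTerm_even {w q : ℂ} (hw : w ≠ 0) (hq0 : q ≠ 0) (r s : ℤ) :
    indefThetaTerm w q (r + s) (s - r) = heckeTerm 1 7 1 w (w * q) q r s := by
  have hsign : (-1 : ℂ) ^ (s - r) = (-1) ^ (r + s) := by
    rw [show s - r = r + s + -2 * r by ring, zpow_add₀ (by norm_num), zpow_mul _ (-2)]
    norm_num
  have hexp : 2 * (r + s) ^ 2 - (s - r) * (3 * (s - r) - 1) / 2 =
      s + (1 * chooseTwo r + 7 * r * s + 1 * chooseTwo s) := by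
    rw [pentagonal_exponent_eq]
    linarith [two_mul_chooseTwo r, two_mul_chooseTwo s, two_mul_chooseTwo (s - r)]
  rw [indefThetaTerm, heckeTerm, hsign, hexp, zpow_add₀ hw, zpow_add₀ hq0, mul_zpow]
  ring

theorem indefThetaTerm_odd {w q : ℂ} (hw : w ≠ 0) (hq0 : q ≠ 0) (r s : ℤ) :
    indefThetaTerm w q (r + s + 1) (s - r) =
      w * q ^ 2 * heckeTerm 1 7 1 (w * q ^ 4) (w * q ^ 5) q r s := by
  have hshift : indefThetaTerm w q (r + s + 1) (s - r) =
      w * q ^ 2 * indefThetaTerm (w * q ^ 4) q (r + s) (s - r) := by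
    rw [indefThetaTerm, indefThetaTerm, zpow_add_one₀ hw, mul_zpow, ← zpow_natCast q 4,
      ← zpow_natCast q 2, ← zpow_mul, show 2 * (r + s + 1) ^ 2 - (s - r) * (3 * (s - r) - 1) / 2 =
        ((2 : ℕ) : ℤ) + ((4 : ℕ) : ℤ) * (r + s) +
          (2 * (r + s) ^ 2 - (s - r) * (3 * (s - r) - 1) / 2) by push_cast; ring,
      zpow_add₀ hq0, zpow_add₀ hq0]
    ring
  rw [hshift, indefThetaTerm_even (mul_ne_zero hw (pow_ne_zero 4 hq0)) hq0, mul_assoc w (q ^ 4),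
    ← pow_succ]

theorem hasIndefSum_indefThetaTerm {w q : ℂ} (hw : w ≠ 0) (hq0 : q ≠ 0) (hq1 : ‖q‖ < 1) :
    HasIndefSum (indefThetaTerm w q)
      (f 1 7 1 w (w * q) q + w * q ^ 2 * f 1 7 1 (w * q ^ 4) (w * q ^ 5) q) := by
  refine hasIndefSum_of_parity ?_ ?_
  · simp only [indefThetaTerm_even hw hq0]
    exact hasSum_heckeTerm one_pos (by norm_num) one_pos _ _ hq0 hq1
  · simp only [indefThetaTerm_odd hw hq0, mul_left_comm _ (w * q ^ 2)]
    exact (hasSum_heckeTerm one_pos (by norm_num) one_pos _ _ hq0 hq1).mul_left _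

theorem indefThetaTerm_natCast {q : ℂ} (hq0 : q ≠ 0) (w : ℂ) (n : ℕ) (j : ℤ) :
    indefThetaTerm w q n j =
      w ^ n * (q ^ (2 * n ^ 2) * ((-1) ^ j * q ^ (-(j * (3 * j - 1) / 2)))) := by
  rw [indefThetaTerm, sub_eq_add_neg, zpow_add₀ hq0, zpow_natCast, ← zpow_natCast q (2 * n ^ 2)]
  push_cast
  ring

theorem indefThetaTerm_neg_one_sub {w v q : ℂ} (hw : w ≠ 0) (hq0 : q ≠ 0) (hv : w * v = q ^ 2)
    (n : ℕ) (j : ℤ) :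
    indefThetaTerm w q (-1 - n) j = q ^ (2 * n) * v ^ (n + 1) *
      (q ^ (2 * n ^ 2) * ((-1) ^ j * q ^ (-(j * (3 * j - 1) / 2)))) := by
  obtain rfl : v = q ^ 2 / w := eq_div_of_mul_eq hw (by rw [mul_comm, hv])
  rw [indefThetaTerm, show -1 - (n : ℤ) = -(n + 1 : ℕ) by push_cast; ring, zpow_neg, zpow_natCast,
    show 2 * (-((n + 1 : ℕ) : ℤ)) ^ 2 - j * (3 * j - 1) / 2 =
      ((2 * n + 2 * (n + 1) + 2 * n ^ 2 : ℕ) : ℤ) + -(j * (3 * j - 1) / 2) by push_cast; ring,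
    zpow_add₀ hq0, zpow_natCast, div_pow]
  field_simp
  ring

theorem sum_indefThetaTerm_sub {w v q : ℂ} (hw : w ≠ 0) (hq0 : q ≠ 0) (hv : w * v = q ^ 2)
    (n : ℕ) :
    ∑ j ∈ Finset.Icc (-(n : ℤ)) n, (indefThetaTerm w q n j - indefThetaTerm w q (-1 - n) j) =
      (w ^ n - q ^ (2 * n) * v ^ (n + 1)) * (q ^ (2 * n ^ 2) * innerA q n) := by
  simp only [indefThetaTerm_natCast hq0, indefThetaTerm_neg_one_sub hw hq0 hv, ← sub_mul,
    ← Finset.mul_sum, innerA]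

theorem hasIndefSum_of_hasSum_blocks {w v q S : ℂ} (hw : w ≠ 0) (hq0 : q ≠ 0) (hq1 : ‖q‖ < 1)
    (hv : w * v = q ^ 2)
    (h : HasSum (fun n : ℕ =>
      (w ^ n - q ^ (2 * n) * v ^ (n + 1)) * (q ^ (2 * n ^ 2) * innerA q n)) S) :
    HasIndefSum (indefThetaTerm w q) S := by
  have hf := hasIndefSum_indefThetaTerm hw hq0 hq1
  have hblocks := hf.hasSum_blocks
  simp only [sum_indefThetaTerm_sub hw hq0 hv] at hblocks
  rwa [h.unique hblocks]

theorem f_one_seven_one_reflect {w v q : ℂ} (hw : w ≠ 0) (hq0 : q ≠ 0) (hv : w * v = q ^ 2) :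
    w * q ^ 2 * f 1 7 1 (w * q ^ 4) (w * q ^ 5) q = -v * f 1 7 1 (v * q ^ 2) (v * q ^ 3) q := by
  obtain rfl : v = q ^ 2 / w := eq_div_of_mul_eq hw (by rw [mul_comm, hv])
  have hx : q ^ (2 * 1 + 7 : ℤ) / (w * q ^ 4) = q ^ 2 / w * q ^ 3 := by
    norm_num [zpow_ofNat]
    field_simp
  have hy : q ^ (2 * 1 + 7 : ℤ) / (w * q ^ 5) = q ^ 2 / w * q ^ 2 := by
    norm_num [zpow_ofNat]
    field_simp
  have hprefactor : q ^ (1 + 7 + 1 : ℤ) / (w * q ^ 4 * (w * q ^ 5)) = 1 / w ^ 2 := by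
    norm_num [zpow_ofNat]
    field_simp
  rw [f_reflect (mul_ne_zero hw (pow_ne_zero 4 hq0)) (mul_ne_zero hw (pow_ne_zero 5 hq0)) hq0, hx,
    hy, hprefactor, f_swap]
  field_simp

theorem summable_pow_mul_innerA {w q : ℂ} (hw : w ≠ 0) (hq0 : q ≠ 0) (hq1 : ‖q‖ < 1) :
    Summable fun n : ℕ => w ^ n * (q ^ (2 * n ^ 2) * innerA q n) := by
  obtain ⟨u, -, hu, -⟩ := hasIndefSum_indefThetaTerm hw hq0 hq1
  refine (hasSum_cone_fiberwise hu).summable.congr fun n => ?_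
  simp only [indefThetaTerm_natCast hq0, innerA, Finset.mul_sum]

theorem indefThetaTerm_neg_zpow {q : ℂ} (hq0 : q ≠ 0) (m n j : ℤ) :
    indefThetaTerm (-q ^ m) q n j =
      (-1) ^ (n + j) * q ^ (2 * n ^ 2 + m * n - j * (3 * j - 1) / 2) := by
  rw [indefThetaTerm, neg_eq_neg_one_mul (q ^ m), mul_zpow, ← zpow_mul, add_sub_right_comm,
    zpow_add₀ hq0 _ (m * n), zpow_add₀ (by norm_num)]
  ring

theorem indefThetaTerm_sq_neg {q : ℂ} (hq0 : q ≠ 0) (m n j : ℤ) :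
    indefThetaTerm (q ^ m) (q ^ 2) n (-j) =
      (-1) ^ j * q ^ (4 * n ^ 2 + m * n - 3 * j ^ 2 - j) := by
  have hexp : 4 * n ^ 2 + m * n - 3 * j ^ 2 - j =
      m * n + 2 * (2 * n ^ 2 - -j * (3 * -j - 1) / 2) := by
    rw [pentagonal_exponent_eq]
    linarith [two_mul_chooseTwo (-j)]
  rw [indefThetaTerm, hexp, zpow_add₀ hq0, zpow_mul q 2, zpow_mul, zpow_ofNat q 2, zpow_neg,
    ← inv_zpow, inv_neg_one, mul_assoc]

/-! ### The four mock theta functions -/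

theorem summable_norm_innerA_one {q : ℂ} (hq0 : q ≠ 0) (hq1 : ‖q‖ < 1) :
    Summable fun r : ℕ => ‖(1 - q ^ (2 * r + 1)) * (q ^ (2 * r ^ 2 + r) * innerA q r)‖ := by
  have h := (summable_pow_mul_innerA hq0 hq0 hq1).sub
    ((summable_pow_mul_innerA (pow_ne_zero 3 hq0) hq0 hq1).mul_left q)
  refine (h.congr fun r => ?_).norm
  ring

theorem summable_norm_innerA_pow {q : ℂ} (hq0 : q ≠ 0) (hq1 : ‖q‖ < 1) :
    Summable fun r : ℕ => ‖(1 - q ^ (4 * r + 2)) * (q ^ (2 * r ^ 2) * innerA q r)‖ := by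
  have h := (summable_pow_mul_innerA one_ne_zero hq0 hq1).sub
    ((summable_pow_mul_innerA (pow_ne_zero 4 hq0) hq0 hq1).mul_left (q ^ 2))
  refine (h.congr fun r => ?_).norm
  ring

theorem hasSum_nu {q : ℂ} (hq0 : q ≠ 0) (hq1 : ‖q‖ < 1) :
    HasSum (fun n : ℕ => (-1) ^ n * q ^ (2 * n ^ 2 + 2 * n) * innerA q n) (Jbar 1 4 q * nu q) := by
  have hq := not_isOfFinOrder_of_norm_lt_one hq1
  have h := (isBaileyPair_innerA_one hq0 hq).hasSum_Jbar hq0 hq1 (summable_norm_innerA_one hq0 hq1)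
  rw [nu, (hasSum_nuTerm hq1).tsum_eq, fineSum]
  simp only [mul_one] at h
  refine h.congr_fun fun n => ?_
  have hn := one_sub_pow_ne_zero hq (Nat.add_one_ne_zero (2 * n))
  field_simp
  ring

theorem hasSum_phi {q : ℂ} (hq0 : q ≠ 0) (hq1 : ‖q‖ < 1) :
    HasSum (fun n : ℕ => (-1) ^ n * q ^ (2 * n ^ 2 + n) * (1 + q ^ (2 * n + 1)) * innerA q n)
      (Jbar 1 4 q * phi q) := by
  have hq := not_isOfFinOrder_of_norm_lt_one hq1
  have h := (isBaileyPair_innerA_pow hq0 hq).hasSum_Jbar hq0 hq1 (summable_norm_innerA_pow hq0 hq1)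
  have hβ : HasSum (fun n => qPoch q (q ^ 2) n * (-q) ^ n * (q ^ (n + 1) + if n = 0 then 1 else 0))
      (phi q) := by
    have hfine := hasSum_qPoch_mul_pow q (norm_sq_lt_one hq1) (t := -q ^ 2)
      (by rw [norm_neg]; exact norm_sq_lt_one hq1)
    rw [phi, (hasSum_phiTerm hq1).tsum_eq, add_comm]
    refine ((hfine.mul_left q).add (hasSum_ite_eq 0 1)).congr_fun fun n => ?_
    split_ifs with hn
    · subst hn
      simp [qPoch_zero]
    · rw [neg_pow (q ^ 2), neg_pow q]
      ring
  rw [hβ.tsum_eq] at h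
  refine h.congr_fun fun n => ?_
  have hn := one_sub_pow_ne_zero hq (Nat.add_one_ne_zero (2 * n))
  rw [show 1 - q ^ (4 * n + 2) = (1 + q ^ (2 * n + 1)) * (1 - q ^ (2 * n + 1)) by ring]
  field_simp
  ring

theorem innerB_eq (q : ℂ) (n : ℕ) : innerB q n = innerA (q ^ 2) n := by
  refine Finset.sum_nbij' (fun j => -j) (fun j => -j) ?_ ?_ (fun _ _ => neg_neg _)
    (fun _ _ => neg_neg _) ?_
  · intro j hj; simp only [Finset.mem_Icc] at *; omega
  · intro j hj; simp only [Finset.mem_Icc] at *; omega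
  · intro j _
    have hexp : -3 * j ^ 2 - j = 2 * -(-j * (3 * -j - 1) / 2) := by
      rw [pentagonal_exponent_eq]
      linarith [two_mul_chooseTwo (-j)]
    rw [zpow_neg (-1 : ℂ), ← inv_zpow, inv_neg_one, hexp, zpow_mul, zpow_ofNat]

theorem hasSum_phibar1 {q : ℂ} (hq0 : q ≠ 0) (hq1 : ‖q‖ < 1) :
    HasSum (fun n : ℕ => q ^ (4 * n ^ 2 + 3 * n) * (1 - q ^ (2 * n + 1)) * innerB q n)
      (J 1 2 q * phibar1 q) := by
  have hQ0 : q ^ 2 ≠ 0 := pow_ne_zero 2 hq0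
  have hQ1 := norm_sq_lt_one hq1
  have hQ := not_isOfFinOrder_of_norm_lt_one hQ1
  have h := (isBaileyPair_innerA_one hQ0 hQ).hasSum_J hq0 hq1 (summable_norm_innerA_one hQ0 hQ1)
  have hphibar1 : ∑' n, qPoch (-q) q (2 * n) * q ^ n * 1 = phibar1 q :=
    tsum_congr fun n => by rw [phibar1Term, mul_one, mul_comm]
  rw [hphibar1] at h
  refine h.congr_fun fun n => ?_
  have hn := one_add_pow_ne_zero hq1 (Nat.add_one_ne_zero (2 * n))
  rw [innerB_eq]
  field_simp
  ring

theorem summable_phibar1Term {q : ℂ} (hq1 : ‖q‖ < 1) : Summable (phibar1Term q) := by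
  have h := (summable_norm_qPoch_mul_qPoch_mul_pow (-q) (q * -q) (norm_sq_lt_one hq1) hq1).of_norm
  refine h.congr fun n => ?_
  rw [phibar1Term, ← qPoch_two_mul, mul_comm]

theorem summable_phibar0Term {q : ℂ} (hq1 : ‖q‖ < 1) : Summable (phibar0Term q) := by
  have hsq : ‖q ^ 2 * q‖ < 1 := by
    rw [norm_mul]
    exact mul_lt_one_of_nonneg_of_lt_one_left (norm_nonneg _) (norm_sq_lt_one hq1) hq1.le
  have h := (summable_norm_qPoch_mul_qPoch_mul_pow (-q) (q * -q) (norm_sq_lt_one hq1) hsq).of_norm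
  refine ((summable_phibar1Term hq1).add (h.mul_left q)).congr fun n => ?_
  rw [phibar0Term, phibar1Term, ← qPoch_two_mul, qPoch_succ]
  ring

theorem hasSum_phibar0 {q : ℂ} (hq0 : q ≠ 0) (hq1 : ‖q‖ < 1) :
    HasSum (fun n : ℕ => q ^ (4 * n ^ 2 + n) * (1 - q ^ (6 * n + 3)) * innerB q n)
      (J 1 2 q * (q * phibar0 q + 1)) := by
  have hQ0 : q ^ 2 ≠ 0 := pow_ne_zero 2 hq0
  have hQ1 := norm_sq_lt_one hq1
  have hQ := not_isOfFinOrder_of_norm_lt_one hQ1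
  have hpair := ((isBaileyPair_innerA_one hQ0 hQ).const_mul q).add (isBaileyPair_innerA_pow hQ0 hQ)
  have hα := ((summable_norm_innerA_one hQ0 hQ1).of_norm.mul_left q).add
    (summable_norm_innerA_pow hQ0 hQ1).of_norm
  have h := hpair.hasSum_J hq0 hq1 hα.norm
  have hβ : HasSum (fun n => qPoch (-q) q (2 * n) * q ^ n *
      (q * 1 + ((q ^ 2) ^ (n + 1) + if n = 0 then 1 else 0))) (q * phibar0 q + 1) := by
    refine (((summable_phibar0Term hq1).hasSum.mul_left q).add (hasSum_ite_eq 0 1)).congr_fun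
      fun n => ?_
    rw [phibar0Term, qPoch_succ]
    split_ifs with hn
    · subst hn
      simp [qPoch_zero]
      ring
    · ring
  rw [hβ.tsum_eq] at h
  refine h.congr_fun fun n => ?_
  have hn := one_add_pow_ne_zero hq1 (Nat.add_one_ne_zero (2 * n))
  rw [innerB_eq]
  field_simp
  ring

theorem hasIndefSum_indefThetaTerm_phi {q : ℂ} (hq0 : q ≠ 0) (hq1 : ‖q‖ < 1) :
    HasIndefSum (indefThetaTerm (-q) q) (Jbar 1 4 q * phi q) :=
  hasIndefSum_of_hasSum_blocks (neg_ne_zero.mpr hq0) hq0 hq1 (v := -q) (by ring) <|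
    (hasSum_phi hq0 hq1).congr_fun fun n => by
      rw [neg_pow q, neg_pow q]
      ring

theorem hasIndefSum_indefThetaTerm_nu {q : ℂ} (hq0 : q ≠ 0) (hq1 : ‖q‖ < 1) :
    HasIndefSum (indefThetaTerm (-q ^ 2) q) (2 * (Jbar 1 4 q * nu q)) :=
  hasIndefSum_of_hasSum_blocks (neg_ne_zero.mpr (pow_ne_zero 2 hq0)) hq0 hq1 (v := -1) (by ring) <|
    ((hasSum_nu hq0 hq1).mul_left 2).congr_fun fun n => by
      rw [neg_pow (q ^ 2)]
      ring

theorem hasIndefSum_indefThetaTerm_phibar0 {q : ℂ} (hq0 : q ≠ 0) (hq1 : ‖q‖ < 1) :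
    HasIndefSum (indefThetaTerm q (q ^ 2)) (J 1 2 q * (q * phibar0 q + 1)) :=
  hasIndefSum_of_hasSum_blocks hq0 (pow_ne_zero 2 hq0) (norm_sq_lt_one hq1) (v := q ^ 3)
    (by ring) <| (hasSum_phibar0 hq0 hq1).congr_fun fun n => by
      rw [innerB_eq]
      ring

theorem hasIndefSum_indefThetaTerm_phibar1 {q : ℂ} (hq0 : q ≠ 0) (hq1 : ‖q‖ < 1) :
    HasIndefSum (indefThetaTerm (q ^ 3) (q ^ 2)) (J 1 2 q * phibar1 q) :=
  hasIndefSum_of_hasSum_blocks (pow_ne_zero 3 hq0) (pow_ne_zero 2 hq0) (norm_sq_lt_one hq1) (v := q)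
    (by ring) <| (hasSum_phibar1 hq0 hq1).congr_fun fun n => by
      rw [innerB_eq]
      ring

theorem hasIndefSum_phi {q : ℂ} (hq0 : q ≠ 0) (hq1 : ‖q‖ < 1) :
    HasIndefSum (fun n j => (-1) ^ (n + j) * q ^ (2 * n ^ 2 + n - j * (3 * j - 1) / 2))
      (Jbar 1 4 q * phi q) :=
  (hasIndefSum_indefThetaTerm_phi hq0 hq1).congr_fun fun n j => by
    simpa only [zpow_one, one_mul] using (indefThetaTerm_neg_zpow hq0 1 n j).symm

theorem hasIndefSum_nu {q : ℂ} (hq0 : q ≠ 0) (hq1 : ‖q‖ < 1) :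
    HasIndefSum (fun n j => (-1) ^ (n + j) * q ^ (2 * n ^ 2 + 2 * n - j * (3 * j - 1) / 2))
      (2 * (Jbar 1 4 q * nu q)) :=
  (hasIndefSum_indefThetaTerm_nu hq0 hq1).congr_fun fun n j =>
    (indefThetaTerm_neg_zpow hq0 2 n j).symm

theorem hasIndefSum_phibar0 {q : ℂ} (hq0 : q ≠ 0) (hq1 : ‖q‖ < 1) :
    HasIndefSum (fun n j => (-1) ^ j * q ^ (4 * n ^ 2 + n - 3 * j ^ 2 - j))
      (J 1 2 q * (q * phibar0 q + 1)) :=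
  (hasIndefSum_indefThetaTerm_phibar0 hq0 hq1).comp_neg_right.congr_fun fun n j => by
    simpa only [zpow_one, one_mul] using (indefThetaTerm_sq_neg hq0 1 n j).symm

theorem hasIndefSum_phibar1 {q : ℂ} (hq0 : q ≠ 0) (hq1 : ‖q‖ < 1) :
    HasIndefSum (fun n j => (-1) ^ j * q ^ (4 * n ^ 2 + 3 * n - 3 * j ^ 2 - j))
      (J 1 2 q * phibar1 q) :=
  (hasIndefSum_indefThetaTerm_phibar1 hq0 hq1).comp_neg_right.congr_fun fun n j =>
    (indefThetaTerm_sq_neg hq0 3 n j).symm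

theorem Jbar_mul_phi_eq {q : ℂ} (hq0 : q ≠ 0) (hq1 : ‖q‖ < 1) :
    Jbar 1 4 q * phi q = f 1 7 1 (-q) (-q ^ 2) q + q * f 1 7 1 (-q ^ 3) (-q ^ 4) q := by
  have hq := neg_ne_zero.mpr hq0
  have h := (hasIndefSum_indefThetaTerm_phi hq0 hq1).unique (hasIndefSum_indefThetaTerm hq hq0 hq1)
  rw [f_one_seven_one_reflect hq hq0 (v := -q) (by ring)] at h
  convert h using 4 <;> ring

theorem Jbar_mul_nu_eq {q : ℂ} (hq0 : q ≠ 0) (hq1 : ‖q‖ < 1) :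
    Jbar 1 4 q * nu q = f 1 7 1 (-q ^ 2) (-q ^ 3) q := by
  have hq := neg_ne_zero.mpr (pow_ne_zero 2 hq0)
  have h := (hasIndefSum_indefThetaTerm_nu hq0 hq1).unique (hasIndefSum_indefThetaTerm hq hq0 hq1)
  rw [f_one_seven_one_reflect hq hq0 (v := -1) (by ring), neg_neg, one_mul, neg_one_mul,
    neg_one_mul, neg_mul, ← pow_succ, ← two_mul] at h
  exact mul_left_cancel₀ two_ne_zero h

theorem J_mul_phibar0_eq {q : ℂ} (hq0 : q ≠ 0) (hq1 : ‖q‖ < 1) :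
    J 1 2 q * (q * phibar0 q + 1) =
      f 1 7 1 q (q ^ 3) (q ^ 2) + q ^ 5 * f 1 7 1 (q ^ 9) (q ^ 11) (q ^ 2) := by
  convert (hasIndefSum_indefThetaTerm_phibar0 hq0 hq1).unique
    (hasIndefSum_indefThetaTerm hq0 (pow_ne_zero 2 hq0) (norm_sq_lt_one hq1)) using 4 <;> ring

theorem J_mul_phibar1_eq {q : ℂ} (hq0 : q ≠ 0) (hq1 : ‖q‖ < 1) :
    J 1 2 q * phibar1 q =
      f 1 7 1 (q ^ 3) (q ^ 5) (q ^ 2) + q ^ 7 * f 1 7 1 (q ^ 11) (q ^ 13) (q ^ 2) := by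
  convert (hasIndefSum_indefThetaTerm_phibar1 hq0 hq1).unique (hasIndefSum_indefThetaTerm
    (pow_ne_zero 3 hq0) (pow_ne_zero 2 hq0) (norm_sq_lt_one hq1)) using 4 <;> ring

end HeckeMock

theorem theorem1p5 (q : ℂ) (hq0 : q ≠ 0) (hq1 : ‖q‖ < 1) :
    -- the identities for `φ`
    (Summable (HeckeMock.phiTerm q) ∧
      HasSum (fun n : ℕ => (-1) ^ n * q ^ (2 * n ^ 2 + n) * (1 + q ^ (2 * n + 1)) *
        HeckeMock.innerA q n) (HeckeMock.Jbar 1 4 q * HeckeMock.phi q) ∧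
      HeckeMock.HasIndefSum
        (fun n j => (-1) ^ (n + j) * q ^ (2 * n ^ 2 + n - j * (3 * j - 1) / 2))
        (HeckeMock.Jbar 1 4 q * HeckeMock.phi q) ∧
      Summable (HeckeMock.fTerm 1 7 1 (-q) (-q ^ 2) q) ∧
      Summable (HeckeMock.fTerm 1 7 1 (-q ^ 3) (-q ^ 4) q) ∧
      HeckeMock.Jbar 1 4 q * HeckeMock.phi q =
        HeckeMock.f 1 7 1 (-q) (-q ^ 2) q + q * HeckeMock.f 1 7 1 (-q ^ 3) (-q ^ 4) q) ∧
    -- the identities for `ν`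
    (Summable (HeckeMock.nuTerm q) ∧
      HasSum (fun n : ℕ => (-1) ^ n * q ^ (2 * n ^ 2 + 2 * n) * HeckeMock.innerA q n)
        (HeckeMock.Jbar 1 4 q * HeckeMock.nu q) ∧
      (∃ S : ℂ, HeckeMock.HasIndefSum
        (fun n j => (-1) ^ (n + j) * q ^ (2 * n ^ 2 + 2 * n - j * (3 * j - 1) / 2)) S ∧
        HeckeMock.Jbar 1 4 q * HeckeMock.nu q = 1 / 2 * S) ∧
      Summable (HeckeMock.fTerm 1 7 1 (-q ^ 2) (-q ^ 3) q) ∧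
      HeckeMock.Jbar 1 4 q * HeckeMock.nu q = HeckeMock.f 1 7 1 (-q ^ 2) (-q ^ 3) q) ∧
    -- the identities for `φ̄₀`
    (Summable (HeckeMock.phibar0Term q) ∧
      HasSum (fun n : ℕ => q ^ (4 * n ^ 2 + n) * (1 - q ^ (6 * n + 3)) * HeckeMock.innerB q n)
        (HeckeMock.J 1 2 q * (q * HeckeMock.phibar0 q + 1)) ∧
      HeckeMock.HasIndefSum
        (fun n j => (-1) ^ j * q ^ (4 * n ^ 2 + n - 3 * j ^ 2 - j))
        (HeckeMock.J 1 2 q * (q * HeckeMock.phibar0 q + 1)) ∧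
      Summable (HeckeMock.fTerm 1 7 1 q (q ^ 3) (q ^ 2)) ∧
      Summable (HeckeMock.fTerm 1 7 1 (q ^ 9) (q ^ 11) (q ^ 2)) ∧
      HeckeMock.J 1 2 q * (q * HeckeMock.phibar0 q + 1) =
        HeckeMock.f 1 7 1 q (q ^ 3) (q ^ 2) +
          q ^ 5 * HeckeMock.f 1 7 1 (q ^ 9) (q ^ 11) (q ^ 2)) ∧
    -- the identities for `φ̄₁`
    (Summable (HeckeMock.phibar1Term q) ∧
      HasSum (fun n : ℕ => q ^ (4 * n ^ 2 + 3 * n) * (1 - q ^ (2 * n + 1)) *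
        HeckeMock.innerB q n) (HeckeMock.J 1 2 q * HeckeMock.phibar1 q) ∧
      HeckeMock.HasIndefSum
        (fun n j => (-1) ^ j * q ^ (4 * n ^ 2 + 3 * n - 3 * j ^ 2 - j))
        (HeckeMock.J 1 2 q * HeckeMock.phibar1 q) ∧
      Summable (HeckeMock.fTerm 1 7 1 (q ^ 3) (q ^ 5) (q ^ 2)) ∧
      Summable (HeckeMock.fTerm 1 7 1 (q ^ 11) (q ^ 13) (q ^ 2)) ∧
      HeckeMock.J 1 2 q * HeckeMock.phibar1 q =
        HeckeMock.f 1 7 1 (q ^ 3) (q ^ 5) (q ^ 2) +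
          q ^ 7 * HeckeMock.f 1 7 1 (q ^ 11) (q ^ 13) (q ^ 2)) := by
  have summable_f {x y Q : ℂ} (hQ0 : Q ≠ 0) (hQ1 : ‖Q‖ < 1) :
      Summable (HeckeMock.fTerm 1 7 1 x y Q) :=
    HeckeMock.summable_fTerm one_pos (by norm_num) one_pos x y hQ0 hQ1
  have hQ0 : q ^ 2 ≠ 0 := pow_ne_zero 2 hq0
  have hQ1 : ‖q ^ 2‖ < 1 := HeckeMock.norm_sq_lt_one hq1
  refine ⟨⟨(HeckeMock.hasSum_phiTerm hq1).summable, HeckeMock.hasSum_phi hq0 hq1,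
    HeckeMock.hasIndefSum_phi hq0 hq1, summable_f hq0 hq1, summable_f hq0 hq1,
    HeckeMock.Jbar_mul_phi_eq hq0 hq1⟩, ?_, ?_, ?_⟩
  · exact ⟨(HeckeMock.hasSum_nuTerm hq1).summable, HeckeMock.hasSum_nu hq0 hq1,
      ⟨_, HeckeMock.hasIndefSum_nu hq0 hq1, by ring⟩, summable_f hq0 hq1,
      HeckeMock.Jbar_mul_nu_eq hq0 hq1⟩
  · exact ⟨HeckeMock.summable_phibar0Term hq1, HeckeMock.hasSum_phibar0 hq0 hq1,
      HeckeMock.hasIndefSum_phibar0 hq0 hq1, summable_f hQ0 hQ1, summable_f hQ0 hQ1,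
      HeckeMock.J_mul_phibar0_eq hq0 hq1⟩
  · exact ⟨HeckeMock.summable_phibar1Term hq1, HeckeMock.hasSum_phibar1 hq0 hq1,
      HeckeMock.hasIndefSum_phibar1 hq0 hq1, summable_f hQ0 hQ1, summable_f hQ0 hQ1,
      HeckeMock.J_mul_phibar1_eq hq0 hq1⟩
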